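/- A compact nilmanifold is a quotient $G/\Gamma$ of a simply connected nilpotent Lie group by a discrete cocompact subgroup; an affine automorphism of $G/\Gamma$ is a map $x\Gamma\mapsto g\,A(x)\Gamma$ with $g\in G$ and $A$ a Lie group automorphism of $G$ with $A(\Gamma)=\Gamma$. A compact infranilmanifold is a manifold finitely covered by a compact nilmanifold, and an affine automorphism of it is a map that lifts to an affine automorphism of a finite cover by a nilmanifold. Let $M,N$ be compact connected smooth manifolds, $M$ an infranilmanifold, and let $\alpha$ be an action of $\mathbb Z^k$ on $M$ by affine automorphisms, some element of which is an Anosov diffeomorphism. Let $x_0\in M$ be a fixed point of $\alpha$ and $p:(\hat M,\hat x_0)\to(M,x_0)$ the universal covering. Let $\beta:\mathbb Z^k\times M\to \mathrm{Diff}^1(N)$ be a $C^1$ cocycle over $\alpha$, i.e. $\beta(a+b,x)=\beta(a,\alpha(b)x)\,\beta(b,x)$ and $(x,y)\mapsto\beta(a,x)y$ is $C^1$ for every $a$, with $\beta(a,x_0)=\mathrm{id}$ for all $a$, and let $\tilde\alpha(a)(x,y)=(\alpha(a)x,\beta(a,x)y)$ be the extended action on $M\times N$. Let $1\le n\le\infty$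 and let $\mathcal W_H$ be a horizontal $\tilde\alpha$-invariant $C^n$ foliation of $M\times N$, i.e. one with leaves of dimension $\dim M$, transverse to the fibers $\{x\}\times N$, and whose tangent distribution is invariant under all $D\tilde\alpha(a)$. Let $\hat{\mathcal W}_H$ be its lift to $\hat M\times N$. Then for all $\hat x\in\hat M$ and $y\in N$ the leaf of $\hat{\mathcal W}_H$ through $(\hat x_0,y)$ meets $\{\hat x\}\times N$ in exactly one point $(\hat x,h(\hat x)y)$, $h(\hat x)$ is a $C^n$ diffeomorphism of $N$, and, with $\pi_1(M,x_0)$ acting on $\hat M$ by deck transformations, $H(\omega)=h(\hat x)^{-1}\circ h(\omega\cdot\hat x)$ does not depend on $\hat x$ and defines a group homomorphism $H:\pi_1(M,x_0)\to\mathrm{Diff}^n(N)$ (the product in $\pi_1$ being ordered so that $\omega\eta$ is $\eta$ followed by $\omega$). Let $K\subset\pi_1(M,x_0)$ be the subgroup generated by all $\alpha(a)_*\omega\cdot\omega^{-1}$, $a\in\mathbb Z^k$, $\omega\in\pi_1(M,x_0)$; it is normal. Moreover: 1. $H(\alpha(a)_*\omega)=H(\omega)$ for all $a\in\mathbb Z^k$,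 $\omega\in\pi_1(M,x_0)$; hence $H$ induces a group homomorphism $\bar H:\pi_1(M,x_0)/K\to\mathrm{Diff}^n(N)$. 2. $K$ has finite index in $\pi_1(M,x_0)$. -/

import Mathlib

open scoped Manifold ContDiff Topology

/-! ### Diffeomorphism groups -/

/-- The group of `C^n` diffeomorphisms of a manifold `X`, as a group of permutations of `X`. -/
def Diff {E H : Type*} [NormedAddCommGroup E] [NormedSpace ℝ E] [TopologicalSpace H]
    (I : ModelWithCorners ℝ E H) (n : WithTop ℕ∞) (X : Type*) [TopologicalSpace X]
    [ChartedSpace H X] :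
    Subgroup (Equiv.Perm X) where
  carrier := {f | ContMDiff I I n f ∧ ContMDiff I I n f.symm}
  mul_mem' := fun {_ _} hf hg => ⟨hf.1.comp hg.1, hg.2.comp hf.2⟩
  one_mem' := ⟨contMDiff_id, contMDiff_id⟩
  inv_mem' := fun {_} hf => ⟨hf.2, hf.1⟩

/-- A diffeomorphism as a continuous map. -/
def Diff.toContinuousMap {E H : Type*} [NormedAddCommGroup E] [NormedSpace ℝ E]
    [TopologicalSpace H] {I : ModelWithCorners ℝ E H} {n : WithTop ℕ∞} {X : Type*} [TopologicalSpace X]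
    [ChartedSpace H X] (f : Diff I n X) : C(X, X) :=
  ⟨f.1, f.2.1.continuous⟩

/-- The group `ℤ^k`, written multiplicatively. -/
abbrev IntLattice (k : ℕ) : Type := Multiplicative (Fin k → ℤ)

/-! ### Anosov diffeomorphisms -/

/-- `f` is Anosov: for some Riemannian metric there are a `Df`-invariant splitting
`TM = Es ⊕ Eu` into nontrivial subbundles and some `l ≥ 1` such that `‖Df^l v‖ < 1` for unit
vectors `v ∈ Es` and `1 < ‖Df^l v‖` for unit vectors `v ∈ Eu`. -/
def IsAnosov {m : ℕ} {M : Type*} [TopologicalSpace M] [ChartedSpace (EuclideanSpace ℝ (Fin m)) M]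
    [IsManifold (𝓡 m) ∞ M] (f : M → M) : Prop :=
  ∃ (g : Bundle.ContMDiffRiemannianMetric (𝓡 m) ∞ (EuclideanSpace ℝ (Fin m))
        (fun x : M => TangentSpace (𝓡 m) x))
    (Es Eu : ∀ x : M, Submodule ℝ (TangentSpace (𝓡 m) x)),
    (∀ x, IsCompl (Es x) (Eu x)) ∧
    (∀ x, Es x ≠ ⊥) ∧ (∀ x, Eu x ≠ ⊥) ∧
    (∀ x, (Es x).map (mfderiv (𝓡 m) (𝓡 m) f x).toLinearMap = Es (f x)) ∧
    (∀ x, (Eu x).map (mfderiv (𝓡 m) (𝓡 m) f x).toLinearMap = Eu (f x)) ∧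
    ∃ l : ℕ, 1 ≤ l ∧ ∀ x,
      (∀ v ∈ Es x, g.inner x v v = 1 →
        g.inner (f^[l] x) (mfderiv (𝓡 m) (𝓡 m) (f^[l]) x v)
          (mfderiv (𝓡 m) (𝓡 m) (f^[l]) x v) < 1) ∧
      (∀ v ∈ Eu x, g.inner x v v = 1 →
        1 < g.inner (f^[l] x) (mfderiv (𝓡 m) (𝓡 m) (f^[l]) x v)
          (mfderiv (𝓡 m) (𝓡 m) (f^[l]) x v))

/-! ### Infranilmanifolds and their affine automorphisms -/

/-- A finite covering `p : G ⧸ Γ → M` of `M` by a compact nilmanifold: `G` is a simply connected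
nilpotent Lie group and `Γ` a discrete cocompact subgroup. As `G → G ⧸ Γ` is a local
diffeomorphism, smoothness of the covering is expressed on `G`. -/
structure NilmanifoldCover (m : ℕ) (M : Type*) [TopologicalSpace M]
    [ChartedSpace (EuclideanSpace ℝ (Fin m)) M] where
  /-- the Lie group -/
  G : Type
  [group : Group G]
  [topology : TopologicalSpace G]
  [charts : ChartedSpace (EuclideanSpace ℝ (Fin m)) G]
  [lie : LieGroup (𝓡 m) ∞ G]
  [t2 : T2Space G]
  [simplyConnected : SimplyConnectedSpace G]
  [nilpotent : Group.IsNilpotent G]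
  /-- the lattice -/
  Γ : Subgroup G
  discrete : DiscreteTopology Γ
  cocompact : CompactSpace (G ⧸ Γ)
  /-- the covering map -/
  p : G ⧸ Γ → M
  isCoveringMap : IsCoveringMap p
  surjective : Function.Surjective p
  finite_fiber : ∀ x, (p ⁻¹' {x}).Finite
  isLocalDiffeomorph : IsLocalDiffeomorph (𝓡 m) (𝓡 m) ∞ (fun x : G => p (x : G ⧸ Γ))

attribute [instance] NilmanifoldCover.group NilmanifoldCover.topology NilmanifoldCover.charts
  NilmanifoldCover.lie NilmanifoldCover.t2 NilmanifoldCover.simplyConnected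
  NilmanifoldCover.nilpotent

/-- `M` is an infranilmanifold: it is finitely covered by a compact nilmanifold. -/
def IsInfranilmanifold (m : ℕ) (M : Type*) [TopologicalSpace M]
    [ChartedSpace (EuclideanSpace ℝ (Fin m)) M] : Prop :=
  Nonempty (NilmanifoldCover m M)

/-- `f` is an affine automorphism of the infranilmanifold `M`: it lifts, on a finite cover
`G ⧸ Γ`, to an affine automorphism `xΓ ↦ g A(x) Γ`, where `A` is an automorphism of the Lie group
`G` with `A(Γ) = Γ` and `g ∈ G`. -/
def IsAffineAutomorphism (m : ℕ) {M : Type*} [TopologicalSpace M]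
    [ChartedSpace (EuclideanSpace ℝ (Fin m)) M] (f : M → M) : Prop :=
  ∃ (C : NilmanifoldCover m M) (A : C.G ≃ₜ* C.G) (g : C.G),
    C.Γ.map (A : C.G →* C.G) = C.Γ ∧
    ∀ x : C.G, f (C.p (x : C.G ⧸ C.Γ)) = C.p ((g * A x : C.G) : C.G ⧸ C.Γ)

/-! ### Cocycles with values in diffeomorphism groups -/

/-- `β` is a `C^1` cocycle over `α` with values in the `C^1` diffeomorphisms of `N`. -/
structure IsCocycle {k m q : ℕ} {M N : Type*}
    [TopologicalSpace M] [ChartedSpace (EuclideanSpace ℝ (Fin m)) M]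
    [TopologicalSpace N] [ChartedSpace (EuclideanSpace ℝ (Fin q)) N]
    (α : IntLattice k →* Diff (𝓡 m) ∞ M) (β : IntLattice k → M → Diff (𝓡 q) 1 N) : Prop where
  map_mul : ∀ a b x, β (a * b) x = β a ((α b).1 x) * β b x
  contMDiff : ∀ a, ContMDiff ((𝓡 m).prod (𝓡 q)) (𝓡 q) 1 (fun z : M × N => (β a z.1).1 z.2)

/-- The extension `(x, y) ↦ (α(a) x, β(a, x) y)` of `α(a)` to `M × N`. -/
noncomputable def extension {k m q : ℕ} {M N : Type*}
    [TopologicalSpace M] [ChartedSpace (EuclideanSpace ℝ (Fin m)) M]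
    [TopologicalSpace N] [ChartedSpace (EuclideanSpace ℝ (Fin q)) N]
    (α : IntLattice k →* Diff (𝓡 m) ∞ M) (β : IntLattice k → M → Diff (𝓡 q) 1 N) (a : IntLattice k)
    (z : M × N) : M × N :=
  ((α a).1 z.1, (β a z.1).1 z.2)

/-! ### Foliations -/

/-- A `C^n` foliation of `X` with leaves of dimension `d` and codimension `c`, given by an atlas of
foliated charts onto `D^d × D^c`; the plaques are the preimages of the disks `D^d × {y}`, and the
plaques of any two charts coincide locally. -/
structure Foliation {E H : Type*} [NormedAddCommGroup E] [NormedSpace ℝ E] [TopologicalSpace H]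
    (I : ModelWithCorners ℝ E H) (n : ℕ∞) (d c : ℕ) (X : Type*) [TopologicalSpace X]
    [ChartedSpace H X] where
  /-- the foliated charts -/
  atlas : Set (OpenPartialHomeomorph X (EuclideanSpace ℝ (Fin d) × EuclideanSpace ℝ (Fin c)))
  covers : ∀ z, ∃ φ ∈ atlas, z ∈ φ.source
  target_eq : ∀ φ ∈ atlas, φ.target = Metric.ball 0 1 ×ˢ Metric.ball 0 1
  contMDiffOn : ∀ φ ∈ atlas,
    ContMDiffOn I 𝓘(ℝ, EuclideanSpace ℝ (Fin d) × EuclideanSpace ℝ (Fin c)) n φ φ.source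
  contMDiffOn_symm : ∀ φ ∈ atlas,
    ContMDiffOn 𝓘(ℝ, EuclideanSpace ℝ (Fin d) × EuclideanSpace ℝ (Fin c)) I n φ.symm φ.target
  compatible : ∀ φ ∈ atlas, ∀ ψ ∈ atlas, ∀ z ∈ φ.source ∩ ψ.source,
    ∃ U ∈ 𝓝 z, ∀ w ∈ U, ∀ w' ∈ U, (φ w).2 = (φ w').2 ↔ (ψ w).2 = (ψ w').2

namespace Foliation

variable {E H : Type*} [NormedAddCommGroup E] [NormedSpace ℝ E] [TopologicalSpace H]
  {I : ModelWithCorners ℝ E H} {n : ℕ∞} {d c : ℕ} {X : Type*} [TopologicalSpace X]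
  [ChartedSpace H X]

/-- The tangent space at `z` of the leaf through `z`. -/
noncomputable def tangent (W : Foliation I n d c X) (z : X) : Submodule ℝ (TangentSpace I z) :=
  ⨅ φ ∈ W.atlas, ⨅ _ : z ∈ φ.source,
    (mfderiv I 𝓘(ℝ, EuclideanSpace ℝ (Fin c)) (fun w => (φ w).2) z).ker

/-- The path `γ` runs in a leaf (and is continuous for the leaf topology, if it is continuous):
in every foliated chart its transverse coordinate is locally constant. -/
def IsLeafwise (W : Foliation I n d c X) (γ : unitInterval → X) : Prop :=
  ∀ φ ∈ W.atlas, ∀ t, γ t ∈ φ.source → ∀ᶠ s in 𝓝 t, (φ (γ s)).2 = (φ (γ t)).2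

/-- The foliation is invariant under `f`: the derivative of `f` maps its tangent distribution
onto itself. -/
def IsInvariant (W : Foliation I n d c X) (f : X → X) : Prop :=
  ∀ z, (W.tangent z).map (mfderiv I I f z).toLinearMap = W.tangent (f z)

end Foliation

/-- The foliation `W` of `M × N` is horizontal: it is transverse to the fibers `{x} × N`, with
leaves of the dimension of `M`. -/
def Foliation.IsHorizontal {m q : ℕ} {n : ℕ∞} {M N : Type*}
    [TopologicalSpace M] [ChartedSpace (EuclideanSpace ℝ (Fin m)) M]
    [TopologicalSpace N] [ChartedSpace (EuclideanSpace ℝ (Fin q)) N]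
    (W : Foliation ((𝓡 m).prod (𝓡 q)) n m q (M × N)) : Prop :=
  ∀ z, IsCompl (W.tangent z)
    (mfderiv ((𝓡 m).prod (𝓡 q)) (𝓡 m) (Prod.fst : M × N → M) z).ker

/-- The leaf through `z` of the lift of `W` to `M' × N`, where `p : M' → M` is a covering:
the set of endpoints of paths from `z` whose projections to `M × N` run in leaves of `W`. -/
def Foliation.liftedLeaf {m q : ℕ} {n : ℕ∞} {M N M' : Type*}
    [TopologicalSpace M] [ChartedSpace (EuclideanSpace ℝ (Fin m)) M]
    [TopologicalSpace N] [ChartedSpace (EuclideanSpace ℝ (Fin q)) N] [TopologicalSpace M']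
    (W : Foliation ((𝓡 m).prod (𝓡 q)) n m q (M × N)) (p : M' → M) (z : M' × N) :
    Set (M' × N) :=
  {z' | ∃ γ : Path z z', W.IsLeafwise (fun t => (p (γ t).1, (γ t).2))}

/-! ### The fundamental group -/

/-- The subgroup generated by the elements `f i σ * σ⁻¹`. -/
def displacementSubgroup {ι P : Type*} [Group P] (f : ι → P →* P) : Subgroup P :=
  Subgroup.closure {g | ∃ i σ, g = f i σ * σ⁻¹}

instance displacementSubgroup_normal {ι P : Type*} [Group P] (f : ι → P →* P) :
    (displacementSubgroup f).Normal := by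
  have key : ∀ i σ, f i σ * σ⁻¹ ∈ displacementSubgroup f := fun i σ =>
    Subgroup.subset_closure ⟨i, σ, rfl⟩
  refine ⟨fun x hx g => ?_⟩
  refine Subgroup.closure_induction
    (p := fun y _ => g * y * g⁻¹ ∈ displacementSubgroup f) ?_ ?_ ?_ ?_ hx
  · rintro _ ⟨i, σ, rfl⟩
    have h := mul_mem (inv_mem (key i g)) (key i (g * σ))
    simpa [mul_assoc] using h
  · simp
  · intro y z _ _ hy hz
    simpa [mul_assoc] using mul_mem hy hz
  · intro y _ hy
    simpa [mul_assoc] using inv_mem hy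

/-- The automorphism `α(a)_*` of `π₁(M, x₀)`, where `x₀` is a fixed point of the action `α`. -/
noncomputable def inducedMap {k m : ℕ} {M : Type*} [TopologicalSpace M]
    [ChartedSpace (EuclideanSpace ℝ (Fin m)) M] (α : IntLattice k →* Diff (𝓡 m) ∞ M) {x₀ : M}
    (hx₀ : ∀ a, (α a).1 x₀ = x₀) (a : IntLattice k) :
    FundamentalGroup M x₀ →* FundamentalGroup M x₀ :=
  FundamentalGroup.mapOfEq (Diff.toContinuousMap (α a)) (hx₀ a)

/-- `D` is the deck transformation of the universal covering `p` induced by `σ ∈ π₁(M, p x')`: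
it maps the base point `x'` to the endpoint of the lift of `σ` that starts at `x'`. -/
def IsDeckTransformation {M M' : Type*} [TopologicalSpace M] [TopologicalSpace M'] {p : M' → M}
    (hp : IsCoveringMap p) (x' : M') (σ : FundamentalGroup M (p x')) (D : M' ≃ₜ M') : Prop :=
  p ∘ D = p ∧ D x' = (hp.monodromy σ ⟨x', rfl⟩ : M')

/-! Holonomy. A horizontal leaf is locally a graph over `M`: the projection to `M` together with the
transverse coordinate of a foliated chart is a coordinate system (`exists_coordinates`, by the
inverse function theorem). Since `N` is compact, a whole fiber can be transported over one connected
neighborhood in `M` (`exists_transport`). These transports agree locally on overlaps, so they are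
the transition functions of a bundle whose fiber `N` carries the discrete topology, that is, of a
covering. Over a simply connected space it has global sections (`exists_flat_section`), which are
the lifted leaves. Transport `Θ x₁ x₂` between fibers is then defined for all pairs of points of
`M'`, and `h = Θ x'`. Nearly every identity afterwards comes from one principle,
`IsHorizontal.eqOn`: two leafwise maps over the same map to `M` that agree at a point agree on a
connected set. It gives the composition rule for `Θ`, its invariance under deck transformations and
hence the homomorphism `H`.

Invariance of `H`. The extended action preserves the tangent distribution, hence the leaves. If `F`
lifts `α(a)` and fixes `x'`, the principle gives `h(F x) = β(a, p x) ∘ h(x)`, because both sides are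
leafwise and `β` is trivial over the fixed point. At a deck translate of `x'` the factor `β` is
again trivial, which is the claim.

Finite index. One Anosov element suffices. On a finite cover by a nilmanifold, a power of it is
covered by an endomorphism `B` of `G` that preserves `Γ`, and `Γ` is the fundamental group of the
nilmanifold. The quotient of `Γ` by its displacement subgroup under `B` is a finitely generated
nilpotent group. If it were infinite, it would have a nonzero homomorphism to `ℝ`, that is, `Γ`
would have a nonzero `B`-invariant homomorphism `χ`. To refute this, `χ` is carried over to `G`:
choose a smooth `c` with `c(uγ) = c(u) + χ(γ)` and average `c(vu) - c(u)` over `G ⧸ Γ` with an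
invariant mean. The result is a homomorphism `X` on `G` at bounded distance from `c`, so it is again
`B`-invariant, and `χ` is trivial if `X` is. It is locally Lipschitz, hence differentiable by
Rademacher's theorem and translation. Its differential at `1` is a linear form invariant under a
hyperbolic map, hence zero, so `X` is trivial. Finally the image of the displacement subgroup in
`π₁(M)` still has finite index because the cover is finite. -/

/-! ### Invariant means for nilpotent groups -/

/-- A continuous linear map that preserves a nonempty compact convex set has a fixed point in it. -/
theorem exists_fixedPoint_of_isCompact_convex {E : Type*} [AddCommGroup E] [Module ℝ E]
    [TopologicalSpace E] [IsTopologicalAddGroup E] [ContinuousSMul ℝ E] [T2Space E]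
    (T : E →L[ℝ] E) {S : Set E} (hS : IsCompact S) (hconv : Convex ℝ S) (hne : S.Nonempty)
    (hT : Set.MapsTo T S S) : ∃ x ∈ S, T x = x := by
  obtain ⟨x, hx⟩ := hne
  have hiter : ∀ i : ℕ, (T ^ i) x ∈ S := by
    intro i
    induction i with
    | zero => simpa using hx
    | succ i ih => rw [pow_succ']; exact hT ih
  -- Cesàro means of the orbit of `x`. The displacement `T (a n) - a n` telescopes to a difference
  -- of two points of `S` divided by `n + 1`, so every limit point is fixed.
  let a : ℕ → E := fun n => ∑ i ∈ Finset.range (n + 1), ((n : ℝ) + 1)⁻¹ • (T ^ i) x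
  have ha : ∀ n, a n ∈ S := fun n => by
    refine hconv.sum_mem (fun i _ => by positivity) ?_ (fun i _ => hiter i)
    simp only [Finset.sum_const, Finset.card_range, nsmul_eq_mul, Nat.cast_add, Nat.cast_one]
    field_simp
  have hdiff : ∀ n, T (a n) - a n = ((n : ℝ) + 1)⁻¹ • ((T ^ (n + 1)) x - x) := by
    intro n
    have : ∀ i, T ((T ^ i) x) = (T ^ (i + 1)) x := fun i => by rw [pow_succ']; rfl
    simp only [a, map_sum, map_smul, this, ← Finset.smul_sum, ← smul_sub, ← Finset.sum_sub_distrib]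
    rw [Finset.sum_range_sub (fun i => (T ^ i) x)]
    simp
  -- `E` need not be metrizable, so a limit along an ultrafilter replaces a convergent subsequence.
  let U : Ultrafilter ℕ := Filter.hyperfilter ℕ
  have hU : (U : Filter ℕ) ≤ Filter.atTop := by
    rw [← Nat.cofinite_eq_atTop]; exact Filter.hyperfilter_le_cofinite
  obtain ⟨z, hzS, hz⟩ := hS.ultrafilter_le_nhds' (U.map a)
    (Filter.Eventually.of_forall ha : ∀ᶠ n in U, a n ∈ S)
  have hz : Filter.Tendsto a U (𝓝 z) := hz
  refine ⟨z, hzS, ?_⟩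
  have h1 : Filter.Tendsto (fun n => T (a n) - a n) U (𝓝 (T z - z)) :=
    ((T.continuous.tendsto z).comp hz).sub hz
  have hb : Bornology.IsVonNBounded ℝ ((fun w : E × E => w.1 - w.2) '' S ×ˢ S) := by
    have := (hS.prod hS).image (f := fun w : E × E => w.1 - w.2) (by fun_prop)
    exact this.isVonNBounded ℝ
  have h2 : Filter.Tendsto (fun n => T (a n) - a n) U (𝓝 0) := by
    simp only [hdiff]
    refine hb.smul_tendsto_zero (Filter.Eventually.of_forall fun n =>
      ⟨((T ^ (n + 1)) x, x), ⟨hiter _, hx⟩, rfl⟩) ?_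
    refine Filter.Tendsto.mono_left ?_ hU
    simpa using tendsto_one_div_add_atTop_nhds_zero_nat (𝕜 := ℝ)
  exact sub_eq_zero.1 (tendsto_nhds_unique h1 h2)

/-- A nilpotent group of continuous linear maps that preserves a nonempty compact convex set has a
common fixed point in it. -/
theorem exists_common_fixedPoint_of_isNilpotent {E : Type*} [AddCommGroup E] [Module ℝ E]
    [TopologicalSpace E] [IsTopologicalAddGroup E] [ContinuousSMul ℝ E] [T2Space E]
    {G : Type*} [Group G] [Group.IsNilpotent G] (ρ : G →* (E →L[ℝ] E)) {S : Set E}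
    (hS : IsCompact S) (hconv : Convex ℝ S) (hne : S.Nonempty)
    (hρ : ∀ g, Set.MapsTo (ρ g) S S) : ∃ x ∈ S, ∀ g, ρ g x = x := by
  have hmul : ∀ g h x, ρ (g * h) x = ρ g (ρ h x) := fun g h x => by rw [map_mul]; rfl
  have hclosed : ∀ g, IsClosed {x | ρ g x = x} := fun g =>
    isClosed_eq (ρ g).continuous continuous_id
  have hconvex : ∀ g, Convex ℝ {x | ρ g x = x} := fun g x hx y hy a b _ _ _ => by
    simp only [Set.mem_ofPred_eq] at hx hy ⊢
    rw [map_add, map_smul, map_smul, hx, hy]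
  -- Climb the upper central series: the points of `S` fixed by its `i`-th term form a compact
  -- convex set, and nonemptiness is inherited from one term to the next.
  have key : ∀ i, (S ∩ ⋂ g ∈ Subgroup.upperCentralSeries G i, {x | ρ g x = x}).Nonempty := by
    intro i
    induction i with
    | zero =>
      obtain ⟨x, hx⟩ := hne
      refine ⟨x, hx, ?_⟩
      simp
    | succ i ih =>
      set S' := S ∩ ⋂ g ∈ Subgroup.upperCentralSeries G i, {x | ρ g x = x} with hS'
      have hS'c : IsCompact S' :=
        hS.inter_right (isClosed_biInter fun g _ => hclosed g)
      have hS'conv : Convex ℝ S' := hconv.inter (convex_iInter₂ fun g _ => hconvex g)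
      have hmem : ∀ x ∈ S', ∀ g ∈ Subgroup.upperCentralSeries G i, ρ g x = x := fun x hx g hg => by
        simpa using Set.mem_iInter₂.1 hx.2 g hg
      -- By compactness, finitely many elements of the next term may be treated at a time.
      have hfin : ∀ F : Finset (Subgroup.upperCentralSeries G (i + 1)),
          (S' ∩ ⋂ g ∈ F, {x | ρ (g : G) x = x}).Nonempty := by
        classical
        intro F
        induction F using Finset.induction_on with
        | empty => simpa using ih
        | insert g F _ ihF =>
          set S'' := S' ∩ ⋂ g ∈ F, {x | ρ (g : G) x = x} with hS''
          -- The `i`-th term is normal and acts trivially on `S'`. Modulo it, `g` commutes with the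
          -- elements of `F`, so `g` preserves their common fixed points.
          have hmaps : Set.MapsTo (ρ (g : G)) S'' S'' := by
            rintro x ⟨hxS', hxF⟩
            refine ⟨⟨hρ _ hxS'.1, Set.mem_iInter₂.2 fun k hk => ?_⟩,
              Set.mem_iInter₂.2 fun k hk => ?_⟩
            · have hk' : (g : G)⁻¹ * k * g ∈ Subgroup.upperCentralSeries G i := by
                simpa using (inferInstance : (Subgroup.upperCentralSeries G i).Normal).conj_mem k hk
                  (g : G)⁻¹
              have := hmem x hxS' _ hk'
              change ρ k (ρ g x) = ρ g x
              conv_rhs => rw [← this]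
              rw [← hmul, ← hmul]; congr 2; group
            · have hk' : (k : G)⁻¹ * ((g : G)⁻¹ * k * g) ∈ Subgroup.upperCentralSeries G i := by
                have := (Subgroup.mem_upperCentralSeries_succ_iff.1 (inv_mem k.2)) (g : G)⁻¹
                simpa [mul_assoc, commutatorElement_def] using this
              have h1 := hmem x hxS' _ hk'
              have h2 : ρ (k : G) x = x := by simpa using Set.mem_iInter₂.1 hxF k hk
              change ρ k (ρ g x) = ρ g x
              conv_rhs => rw [← h2, ← h1]
              rw [← hmul, ← hmul, ← hmul]; congr 2; group
          obtain ⟨x, hx, hgx⟩ := exists_fixedPoint_of_isCompact_convex (ρ (g : G))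
            (hS'c.inter_right (isClosed_biInter fun (g : Subgroup.upperCentralSeries G (i + 1)) _ =>
              hclosed g))
            (hS'conv.inter (convex_iInter₂ fun (g : Subgroup.upperCentralSeries G (i + 1)) _ =>
              hconvex g)) ihF hmaps
          refine ⟨x, hx.1, ?_⟩
          rw [Finset.set_biInter_insert]
          exact ⟨hgx, hx.2⟩
      obtain ⟨x, hx, hx'⟩ := hS'c.inter_iInter_nonempty
        (fun g : Subgroup.upperCentralSeries G (i + 1) => {x | ρ (g : G) x = x})
        (fun g => hclosed g) hfin
      refine ⟨x, hx.1, Set.mem_iInter₂.2 fun g hg => ?_⟩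
      exact Set.mem_iInter.1 hx' ⟨g, hg⟩
  obtain ⟨n, hn⟩ := (Group.isNilpotent_iff G).1 inferInstance
  obtain ⟨x, hx, hx'⟩ := key n
  refine ⟨x, hx, fun g => ?_⟩
  have : g ∈ Subgroup.upperCentralSeries G n := by rw [hn]; trivial
  simpa using Set.mem_iInter₂.1 hx' g this

/-- A nilpotent group of homeomorphisms of a compact space has an invariant mean. -/
theorem exists_invariant_mean (G Y : Type*) [Group G] [Group.IsNilpotent G] [TopologicalSpace Y]
    [CompactSpace Y] [Nonempty Y] [MulAction G Y] [ContinuousConstSMul G Y] :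
    ∃ μ : C(Y, ℝ) →L[ℝ] ℝ, μ 1 = 1 ∧ ‖μ‖ ≤ 1 ∧
      ∀ (g : G) (f : C(Y, ℝ)), μ (f.comp ⟨fun y => g • y, continuous_const_smul g⟩) = μ f := by
  let τ : G → C(Y, Y) := fun g => ⟨fun y => g • y, continuous_const_smul g⟩
  let P : G → (C(Y, ℝ) →L[ℝ] C(Y, ℝ)) := fun g =>
    { toFun := fun f => f.comp (τ g)
      map_add' := fun _ _ => rfl
      map_smul' := fun _ _ => rfl
      cont := ContinuousMap.continuous_precomp (τ g) }
  let ρ : G →* (WeakDual ℝ C(Y, ℝ) →L[ℝ] WeakDual ℝ C(Y, ℝ)) :=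
    { toFun := fun g =>
        { toFun := fun μ => StrongDual.toWeakDual ((WeakDual.toStrongDual μ).comp (P g))
          map_add' := fun μ ν => rfl
          map_smul' := fun c μ => rfl
          cont := WeakDual.continuous_of_continuous_eval fun f => WeakDual.eval_continuous _ }
      map_one' := by
        refine ContinuousLinearMap.ext fun μ => ContinuousLinearMap.ext fun f => ?_
        change μ (f.comp (τ 1)) = μ f
        congr 1; ext y; simp [τ]
      map_mul' := fun g h => by
        refine ContinuousLinearMap.ext fun μ => ContinuousLinearMap.ext fun f => ?_
        change μ (f.comp (τ (g * h))) = μ ((f.comp (τ g)).comp (τ h))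
        congr 1; ext y; simp [τ, mul_smul] }
  -- The means: compact for the weak-* topology by Banach–Alaoglu, and nonempty because of point
  -- evaluations.
  let S : Set (WeakDual ℝ C(Y, ℝ)) :=
    (WeakDual.toStrongDual ⁻¹' Metric.closedBall (0 : StrongDual ℝ C(Y, ℝ)) 1) ∩ {μ | μ 1 = 1}
  have hS : IsCompact S := (WeakDual.isCompact_closedBall (0 : StrongDual ℝ C(Y, ℝ)) 1).inter_right
    (isClosed_eq (WeakDual.eval_continuous _) continuous_const)
  have hconv : Convex ℝ S := by
    refine ((convex_closedBall (0 : StrongDual ℝ C(Y, ℝ)) 1).linear_preimage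
      (WeakDual.toStrongDual (𝕜 := ℝ) (E := C(Y, ℝ))).toLinearMap).inter ?_
    intro μ hμ ν hν a b _ _ hab
    simp only [Set.mem_ofPred_eq] at hμ hν ⊢
    change a • μ 1 + b • ν 1 = 1
    rw [hμ, hν]; simpa using hab
  have hne : S.Nonempty := by
    obtain ⟨y⟩ := ‹Nonempty Y›
    refine ⟨StrongDual.toWeakDual (ContinuousMap.evalCLM ℝ y), ?_, ?_⟩
    · refine (mem_closedBall_zero_iff (E := StrongDual ℝ C(Y, ℝ))).2 ?_
      refine ContinuousLinearMap.opNorm_le_bound _ zero_le_one fun f => ?_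
      rw [one_mul]
      exact f.norm_coe_le_norm y
    · rfl
  have hρ : ∀ g, Set.MapsTo (ρ g) S S := by
    rintro g μ ⟨h1, h2⟩
    refine ⟨?_, ?_⟩
    · replace h1 := (mem_closedBall_zero_iff (E := StrongDual ℝ C(Y, ℝ))).1 h1
      refine (mem_closedBall_zero_iff (E := StrongDual ℝ C(Y, ℝ))).2 ?_
      refine ContinuousLinearMap.opNorm_le_bound _ zero_le_one fun f => ?_
      change ‖WeakDual.toStrongDual μ (f.comp (τ g))‖ ≤ _
      refine ((WeakDual.toStrongDual μ).le_of_opNorm_le h1 _).trans ?_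
      gcongr
      exact (ContinuousMap.norm_le _ (norm_nonneg _)).2 fun y => f.norm_coe_le_norm _
    · change μ ((1 : C(Y, ℝ)).comp (τ g)) = 1
      rw [← h2]; rfl
  obtain ⟨μ, hμ, hinv⟩ := exists_common_fixedPoint_of_isNilpotent ρ hS hconv hne hρ
  refine ⟨WeakDual.toStrongDual μ, hμ.2, (mem_closedBall_zero_iff (E := StrongDual ℝ C(Y, ℝ))).1 hμ.1,
    fun g f => ?_⟩
  exact congrArg (fun ν : WeakDual ℝ C(Y, ℝ) => ν f) (hinv g)

/-! ### Finitely generated nilpotent groups without homomorphisms to `ℝ` -/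

/-- An infinite finitely generated abelian group has an element on which some homomorphism to `ℝ`
does not vanish. -/
theorem exists_hom_real_ne_zero_of_infinite (A : Type*) [AddCommGroup A] [AddGroup.FG A]
    [Infinite A] : ∃ (f : A →+ ℝ) (a : A), f a ≠ 0 := by
  obtain ⟨n, ι, _, p, hp, e, ⟨f⟩⟩ := AddCommGroup.equiv_free_prod_directSum_zmod A
  rcases Nat.eq_zero_or_pos n with rfl | hn
  · exfalso
    have : ∀ i, NeZero (p i ^ e i) := fun i => ⟨pow_ne_zero _ (hp i).ne_zero⟩
    classical
    have : Finite (DirectSum ι fun i => ZMod (p i ^ e i)) :=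
      Finite.of_equiv _ (DirectSum.addEquivProd fun i => ZMod (p i ^ e i)).symm.toEquiv
    have : Finite A := Finite.of_equiv _ f.symm.toEquiv
    exact not_finite A
  · let g : (Fin n →₀ ℤ) →+ ℝ := (Int.castAddHom ℝ).comp (Finsupp.applyAddHom ⟨0, hn⟩)
    refine ⟨g.comp ((AddMonoidHom.fst _ _).comp f.toAddMonoidHom),
      f.symm (Finsupp.single ⟨0, hn⟩ 1, 0), ?_⟩
    simp [g]

/-- A finitely generated nilpotent group without nontrivial homomorphisms to `ℝ` is finite. -/
theorem finite_of_isNilpotent_of_hom_real_trivial (Q : Type*) [Group Q] [Group.IsNilpotent Q]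
    [Group.FG Q] (hQ : ∀ f : Q →* Multiplicative ℝ, f = 1) : Finite Q := by
  suffices H : Group.FG Q → (∀ f : Q →* Multiplicative ℝ, f = 1) → Finite Q from H ‹_› hQ
  clear hQ
  refine Group.nilpotent_center_quotient_ind
    (P := fun Q _ _ => Group.FG Q → (∀ f : Q →* Multiplicative ℝ, f = 1) → Finite Q) Q ?_ ?_
  · intro Q _ _ _ _; infer_instance
  · intro Q _ _ ih hfg hQ
    have : Finite (Q ⧸ Subgroup.center Q) := ih inferInstance fun f => by
      refine MonoidHom.ext fun x => ?_
      obtain ⟨x, rfl⟩ := QuotientGroup.mk_surjective x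
      exact DFunLike.congr_fun (hQ (f.comp (QuotientGroup.mk' _))) x
    have hfi : (Subgroup.center Q).FiniteIndex := Subgroup.finiteIndex_of_finite_quotient
    have hcfg : Group.FG (Subgroup.center Q) := inferInstance
    -- The center has finite index by induction, and the transfer into it is `x ↦ x ^ index`. If the
    -- center were infinite, composing the transfer with a nonzero homomorphism from the center to
    -- `ℝ` would give a nontrivial homomorphism on `Q`.
    have hfin : Finite (Subgroup.center Q) := by
      by_contra hinf
      rw [not_finite_iff_infinite] at hinf
      let _ : CommGroup (Subgroup.center Q) :=
        { (inferInstance : Group (Subgroup.center Q)) with mul_comm := mul_comm' }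
      have : Infinite (Additive (Subgroup.center Q)) := hinf
      obtain ⟨f, a, hfa⟩ := exists_hom_real_ne_zero_of_infinite (Additive (Subgroup.center Q))
      have h1 := DFunLike.congr_fun (hQ ((AddMonoidHom.toMultiplicativeRight f).comp
        (MonoidHom.transferCenterPow Q))) (a.toMul : Q)
      have h2 : MonoidHom.transferCenterPow Q (a.toMul : Q) =
          a.toMul ^ (Subgroup.center Q).index := Subtype.ext (by simp)
      rw [MonoidHom.comp_apply, h2] at h1
      have h3 : f ((Subgroup.center Q).index • a) = 0 := h1
      rw [map_nsmul, smul_eq_zero] at h3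
      exact h3.elim hfi.index_ne_zero hfa
    exact Finite.of_equiv _ (Subgroup.groupEquivQuotientProdSubgroup (s := Subgroup.center Q)).symm

/-! ### Homomorphisms of cocompact subgroups of nilpotent groups -/

/-- A cocompact subgroup of a locally compact group has a compact set of representatives. -/
theorem Subgroup.exists_isCompact_mul_eq {G : Type*} [Group G] [TopologicalSpace G]
    [IsTopologicalGroup G] [LocallyCompactSpace G] (Γ : Subgroup G) [CompactSpace (G ⧸ Γ)] :
    ∃ K : Set G, IsCompact K ∧ ∀ g : G, ∃ k ∈ K, ∃ γ ∈ Γ, g = k * γ := by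
  have hopen : IsOpenMap ((↑) : G → G ⧸ Γ) := QuotientGroup.isOpenMap_coe
  choose L hLc hL using fun g : G => exists_compact_mem_nhds g
  obtain ⟨t, ht⟩ := (isCompact_univ (X := G ⧸ Γ)).elim_finite_subcover
    (fun g : G => ((↑) : G → G ⧸ Γ) '' interior (L g)) (fun g => hopen _ isOpen_interior)
    (fun y _ => by
      obtain ⟨g, rfl⟩ := QuotientGroup.mk_surjective y
      exact Set.mem_iUnion.2 ⟨g, g, mem_interior_iff_mem_nhds.2 (hL g), rfl⟩)
  refine ⟨⋃ g ∈ t, L g, t.isCompact_biUnion fun g _ => hLc g, fun g => ?_⟩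
  have := ht (Set.mem_univ (g : G ⧸ Γ))
  simp only [Set.mem_iUnion] at this
  obtain ⟨i, hi, k, hk, hkg⟩ := this
  refine ⟨k, Set.mem_biUnion hi (interior_subset hk), k⁻¹ * g, QuotientGroup.eq.1 hkg, by group⟩

/-- Let `c` be a continuous function on a nilpotent group `G` that is equivariant under a
homomorphism `χ` of a cocompact subgroup to `ℝ`. Then `c` is at bounded distance from a
homomorphism `X`, in the strong sense that `c (v * u) - c u - X v` is bounded; and `X` inherits
moduli of continuity from `c`. -/
theorem exists_hom_real_bounded_sub {G : Type*} [Group G] [TopologicalSpace G]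
    [IsTopologicalGroup G] [LocallyCompactSpace G] [Group.IsNilpotent G] (Γ : Subgroup G)
    [CompactSpace (G ⧸ Γ)] (χ : Γ →* Multiplicative ℝ) (c : G → ℝ) (hcont : Continuous c)
    (hc : ∀ (u : G) (γ : Γ), c (u * γ) = c u + (χ γ).toAdd) :
    ∃ X : G →* Multiplicative ℝ,
      (∃ C, ∀ v u, |c (v * u) - c u - (X v).toAdd| ≤ C) ∧
      ∀ v w δ, (∀ u, |c (v * u) - c (w * u)| ≤ δ) → |(X v).toAdd - (X w).toAdd| ≤ δ := by
  obtain ⟨μ, hμ1, hμn, hμinv⟩ := exists_invariant_mean G (G ⧸ Γ)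
  -- Both terms of `c (v * u) - c u` change by the same `χ γ` when `u` is multiplied by `γ`, so the
  -- difference descends to `G ⧸ Γ`.
  let φ : G → C(G ⧸ Γ, ℝ) := fun v =>
    ⟨Quotient.lift (fun u => c (v * u) - c u) (by
      intro a b hab
      have hab : a⁻¹ * b ∈ Γ := QuotientGroup.leftRel_apply.1 hab
      have h1 := hc a ⟨_, hab⟩
      have h2 := hc (v * a) ⟨_, hab⟩
      simp only [mul_assoc, mul_inv_cancel_left] at h1 h2
      change c (v * a) - c a = c (v * b) - c b
      rw [h1, h2]; ring),
      Continuous.quotient_lift (by fun_prop) _⟩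
  have hφ : ∀ v u : G, φ v (u : G ⧸ Γ) = c (v * u) - c u := fun v u => rfl
  have hbound : ∀ (f : C(G ⧸ Γ, ℝ)) (δ : ℝ), (∀ u : G, |f u| ≤ δ) → |μ f| ≤ δ := by
    intro f δ hf
    have hδ : 0 ≤ δ := (abs_nonneg _).trans (hf 1)
    have h1 : ‖f‖ ≤ δ := (ContinuousMap.norm_le _ hδ).2 fun y => by
      obtain ⟨u, rfl⟩ := QuotientGroup.mk_surjective y
      exact hf u
    have h2 := μ.le_of_opNorm_le hμn f
    rw [one_mul] at h2
    exact (Real.norm_eq_abs _ ▸ h2).trans h1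
  -- The cocycle identity `φ (v * w) = φ v ∘ w + φ w` becomes additivity because the mean is
  -- invariant under `w`.
  let X : G →* Multiplicative ℝ :=
    { toFun := fun v => Multiplicative.ofAdd (μ (φ v))
      map_one' := by
        have : φ 1 = 0 := by
          ext y
          obtain ⟨u, rfl⟩ := QuotientGroup.mk_surjective y
          rw [hφ]; simp
        rw [this, map_zero]; rfl
      map_mul' := fun v w => by
        have : φ (v * w) = (φ v).comp ⟨fun y => w • y, continuous_const_smul w⟩ + φ w := by
          ext y
          obtain ⟨u, rfl⟩ := QuotientGroup.mk_surjective y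
          change φ (v * w) (u : G ⧸ Γ) = φ v ((w * u : G) : G ⧸ Γ) + φ w (u : G ⧸ Γ)
          rw [hφ, hφ, hφ, mul_assoc]; ring
        rw [this, map_add, hμinv, ofAdd_add] }
  have hX : ∀ v, (X v).toAdd = μ (φ v) := fun v => rfl
  refine ⟨X, ?_, fun v w δ h => ?_⟩
  swap
  · rw [hX, hX, ← map_sub]
    refine hbound _ _ fun u => ?_
    rw [ContinuousMap.sub_apply, hφ, hφ, sub_sub_sub_cancel_right]
    exact h u
  obtain ⟨K, hK, hKΓ⟩ := Γ.exists_isCompact_mul_eq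
  obtain ⟨C, hC⟩ : ∃ C, ∀ k ∈ K, ∀ u, |c (k * u) - c u| ≤ C := by
    obtain ⟨C, hC⟩ := (hK.prod hK).exists_bound_of_continuousOn
      (f := fun z : G × G => c (z.1 * z.2) - c z.2) (by fun_prop)
    refine ⟨C, fun k hk u => ?_⟩
    obtain ⟨l, hl, γ, hγ, rfl⟩ := hKΓ u
    have h1 := hc (k * l) ⟨γ, hγ⟩
    have h2 := hc l ⟨γ, hγ⟩
    simp only [mul_assoc] at h1 h2
    rw [h1, h2, add_sub_add_right_eq_sub]
    exact hC (k, l) ⟨hk, hl⟩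
  have key : ∀ i, ∃ C, ∀ v ∈ Subgroup.upperCentralSeries G i, ∀ u,
      |c (v * u) - c u - (X v).toAdd| ≤ C := by
    intro i
    induction i with
    | zero =>
      refine ⟨0, fun v hv u => ?_⟩
      have hv : v = 1 := by simpa using hv
      simp [hv]
    | succ i ih =>
      obtain ⟨D, hD⟩ := ih
      refine ⟨2 * (D + 2 * C), fun v hv u => ?_⟩
      -- Reduce `u` to `k ∈ K` and write `v * k = [v, k] * (k * v)`. The commutator lies in the
      -- previous term, where the bound is `D`, and `X` kills it; removing `k` from `k * v` and from
      -- `k * 1` costs `C` each. The mean `X v` is then as close to the value at `1`, which doubles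
      -- the constant.
      have hosc : ∀ u, |(c (v * u) - c u) - (c (v * 1) - c 1)| ≤ D + 2 * C := by
        intro u
        obtain ⟨k, hk, γ, hγ, rfl⟩ := hKΓ u
        have h1 := hc (v * k) ⟨γ, hγ⟩
        have h2 := hc k ⟨γ, hγ⟩
        simp only [mul_assoc] at h1 h2
        rw [h1, h2, add_sub_add_right_eq_sub]
        have hcomm : v * k * v⁻¹ * k⁻¹ ∈ Subgroup.upperCentralSeries G i :=
          Subgroup.mem_upperCentralSeries_succ_iff.1 hv k
        have hXc : (X (v * k * v⁻¹ * k⁻¹)).toAdd = 0 := by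
          simp only [map_mul, map_inv, toAdd_mul, toAdd_inv]; ring
        have h3 := hD _ hcomm (k * v)
        rw [hXc, sub_zero, show v * k * v⁻¹ * k⁻¹ * (k * v) = v * k by group] at h3
        have h4 := hC k hk v
        have h5 := hC k hk 1
        rw [mul_one] at h5 ⊢
        rw [abs_le] at *
        constructor <;> linarith [h3.1, h3.2, h4.1, h4.2, h5.1, h5.2]
      have hmean : |(X v).toAdd - (c (v * 1) - c 1)| ≤ D + 2 * C := by
        have : (X v).toAdd - (c (v * 1) - c 1) =
            μ (φ v - (c (v * 1) - c 1) • (1 : C(G ⧸ Γ, ℝ))) := by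
          rw [map_sub, map_smul, hμ1, hX]; simp
        rw [this]
        refine hbound _ _ fun u => ?_
        simpa [hφ] using hosc u
      have h1 := hosc u
      rw [abs_le] at *
      constructor <;> linarith [h1.1, h1.2, hmean.1, hmean.2]
  obtain ⟨n, hn⟩ := (Group.isNilpotent_iff G).1 ‹_›
  obtain ⟨D, hD⟩ := key n
  exact ⟨D, fun v u => hD v (by rw [hn]; trivial) u⟩

/-- A homomorphism to `ℝ` with bounded values is trivial. -/
theorem hom_real_eq_one_of_bounded {G : Type*} [Group G] (X : G →* Multiplicative ℝ) {C : ℝ}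
    (h : ∀ g, |(X g).toAdd| ≤ C) : X = 1 := by
  ext g
  by_contra hg
  have hg : (X g).toAdd ≠ 0 := hg
  obtain ⟨n, hn⟩ := exists_nat_gt (C / |(X g).toAdd|)
  have h1 := h (g ^ n)
  rw [map_pow, toAdd_pow, nsmul_eq_mul, abs_mul, Nat.abs_cast] at h1
  rw [div_lt_iff₀ (abs_pos.2 hg)] at hn
  exact absurd h1 (not_le.2 hn)

/-! ### Discrete cocompact subgroups -/

/-- A discrete subgroup meets a compact set in finitely many elements. -/
theorem Subgroup.finite_setOf_mem_of_isCompact {G : Type*} [Group G] [TopologicalSpace G]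
    [IsTopologicalGroup G] [T2Space G] (Γ : Subgroup G) [DiscreteTopology Γ] {K : Set G}
    (hK : IsCompact K) : {γ : Γ | (γ : G) ∈ K}.Finite := by
  have h := Γ.tendsto_coe_cofinite_of_discrete (isDiscrete_iff_discreteTopology.2 inferInstance)
  have h2 := h (hK.compl_mem_cocompact)
  rw [Filter.mem_map, Filter.mem_cofinite] at h2
  refine h2.subset fun γ hγ => ?_
  simpa using hγ

open scoped Pointwise in
/-- A discrete cocompact subgroup of a connected locally compact group is finitely generated. -/
theorem Subgroup.fg_of_discrete_of_cocompact {G : Type*} [Group G] [TopologicalSpace G]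
    [IsTopologicalGroup G] [T2Space G] [LocallyCompactSpace G] [ConnectedSpace G] (Γ : Subgroup G)
    [DiscreteTopology Γ] [CompactSpace (G ⧸ Γ)] : Group.FG Γ := by
  obtain ⟨K, hK, hKΓ⟩ := Γ.exists_isCompact_mul_eq
  obtain ⟨L, hL, hKL⟩ := exists_compact_superset hK
  have hS : {γ : Γ | (γ : G) ∈ L⁻¹ * L}.Finite :=
    Γ.finite_setOf_mem_of_isCompact (hL.inv.mul hL)
  let Λ : Subgroup Γ := Subgroup.closure {γ : Γ | (γ : G) ∈ L⁻¹ * L}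
  have hopen : ∀ γ : Γ, IsOpen {g : G | g * (γ : G)⁻¹ ∈ interior L} := fun γ =>
    isOpen_interior.preimage (continuous_mul_const _)
  -- The translates `interior L * γ` cover `G`. If those for `γ` and `η` meet, then `η * γ⁻¹ ∈ L⁻¹ *
  -- L` lies in `Λ`. So the translates by `Λ` and by its complement are disjoint open sets, and
  -- connectedness leaves only the former.
  let A : Set G := ⋃ γ ∈ Λ, {g : G | g * (γ : G)⁻¹ ∈ interior L}
  have hAo : IsOpen A := isOpen_biUnion fun γ _ => hopen γ
  let A' : Set G := ⋃ γ ∈ (Λ : Set Γ)ᶜ, {g : G | g * (γ : G)⁻¹ ∈ interior L}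
  have hA'o : IsOpen A' := isOpen_biUnion fun γ _ => hopen γ
  have hunion : A ∪ A' = Set.univ := by
    refine Set.eq_univ_of_forall fun g => ?_
    obtain ⟨k, hk, γ, hγ, rfl⟩ := hKΓ g
    by_cases h : (⟨γ, hγ⟩ : Γ) ∈ Λ
    · exact Or.inl (Set.mem_biUnion h (by simpa using hKL hk))
    · exact Or.inr (Set.mem_biUnion (show (⟨γ, hγ⟩ : Γ) ∈ (Λ : Set Γ)ᶜ from h)
        (by simpa using hKL hk))
  have hdisj : Disjoint A A' := by
    rw [Set.disjoint_left]
    intro g hg hg'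
    simp only [A, A', Set.mem_iUnion] at hg hg'
    obtain ⟨γ, hγ, h1⟩ := hg
    obtain ⟨η, hη, h2⟩ := hg'
    refine hη ?_
    have h3 : η * γ⁻¹ ∈ Λ := Subgroup.subset_closure
      ⟨(g * (η : G)⁻¹)⁻¹, Set.inv_mem_inv.2 (interior_subset h2), g * (γ : G)⁻¹,
        interior_subset h1, by simp⟩
    simpa using mul_mem h3 hγ
  have hAc : IsClopen A := by
    refine ⟨⟨?_⟩, hAo⟩
    have : IsCompl A A' := ⟨hdisj, codisjoint_iff.2 hunion⟩
    rwa [this.compl_eq]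
  have hAuniv : A = Set.univ := by
    refine hAc.eq_univ ?_
    obtain ⟨k, hk, -⟩ := hKΓ 1
    exact ⟨k, Set.mem_biUnion (one_mem Λ) (by simpa using hKL hk)⟩
  have hΛ : Λ = ⊤ := by
    rw [eq_top_iff]
    intro γ _
    obtain ⟨k, hk, -⟩ := hKΓ 1
    have hmem : k * (γ : G) ∈ A := by rw [hAuniv]; trivial
    by_contra hγ
    exact Set.disjoint_left.1 hdisj hmem
      (Set.mem_biUnion (show γ ∈ (Λ : Set Γ)ᶜ from hγ) (by simpa using hKL hk))
  exact Group.fg_iff.2 ⟨_, hΛ, hS⟩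

open scoped Pointwise in
/-- For a discrete cocompact subgroup `Γ` of a Lie group `G` and a homomorphism `χ : Γ → ℝ` there is
a smooth function `c` on `G` with `c (u * γ) = c u + χ γ`. -/
theorem exists_contMDiff_equivariant {m : ℕ} {G : Type*} [Group G] [TopologicalSpace G]
    [ChartedSpace (EuclideanSpace ℝ (Fin m)) G] [LieGroup (𝓡 m) ∞ G] [T2Space G]
    (Γ : Subgroup G) [DiscreteTopology Γ] [CompactSpace (G ⧸ Γ)] (χ : Γ →* Multiplicative ℝ) :
    ∃ c : G → ℝ, ContMDiff (𝓡 m) 𝓘(ℝ, ℝ) ∞ c ∧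
      ∀ (u : G) (γ : Γ), c (u * γ) = c u + (χ γ).toAdd := by
  have : IsTopologicalGroup G := topologicalGroup_of_lieGroup (𝓡 m) ∞
  have : LocallyCompactSpace G := Manifold.locallyCompact_of_finiteDimensional (𝓡 m)
  have : IsManifold (𝓡 m) ∞ G := inferInstance
  obtain ⟨K, hK, hKΓ⟩ := Γ.exists_isCompact_mul_eq
  -- a smooth compactly supported function, positive on `K`
  let b : ∀ g : G, SmoothBumpFunction (𝓡 m) g := fun g => Classical.arbitrary _
  obtain ⟨t, ht⟩ := hK.elim_nhds_subcover (fun g => {u | 0 < b g u}) (fun g _ => by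
    filter_upwards [(b g).eventuallyEq_one] with u hu
    rw [hu]; exact zero_lt_one)
  let θ : G → ℝ := fun u => ∑ g ∈ t, b g u
  have hθ0 : ∀ u, 0 ≤ θ u := fun u => Finset.sum_nonneg fun g _ => (b g).nonneg
  have hθK : ∀ u ∈ K, 0 < θ u := fun u hu => by
    obtain ⟨g, hg, hgu⟩ := Set.mem_iUnion₂.1 (ht.2 hu)
    exact (hgu : 0 < b g u).trans_le (Finset.single_le_sum (f := fun g => b g u)
      (fun g _ => (b g).nonneg) hg)
  have hθs : ContMDiff (𝓡 m) 𝓘(ℝ, ℝ) ∞ θ := contMDiff_finsetSum fun g _ => (b g).contMDiff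
  have hθc : ∃ L, IsCompact L ∧ ∀ u, θ u ≠ 0 → u ∈ L := by
    refine ⟨⋃ g ∈ t, tsupport (b g), t.isCompact_biUnion fun g _ => (b g).hasCompactSupport,
      fun u hu => ?_⟩
    obtain ⟨g, hg, hgu⟩ := Finset.exists_ne_zero_of_sum_ne_zero hu
    exact Set.mem_biUnion hg (subset_tsupport _ hgu)
  obtain ⟨L, hL, hθL⟩ := hθc
  have htrans : ∀ γ : Γ, ContMDiff (𝓡 m) 𝓘(ℝ, ℝ) ∞ fun u => θ (u * γ) := fun γ =>
    hθs.comp (contMDiff_mul_right (a := (γ : G)))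
  have hlf : ∀ u : G, ∃ V ∈ 𝓝 u, {γ : Γ | ∃ v ∈ V, θ (v * γ) ≠ 0}.Finite := by
    intro u
    obtain ⟨V, hVc, hV⟩ := exists_compact_mem_nhds u
    refine ⟨V, hV, (Γ.finite_setOf_mem_of_isCompact (hVc.inv.mul hL)).subset ?_⟩
    rintro γ ⟨v, hv, hvγ⟩
    exact ⟨v⁻¹, Set.inv_mem_inv.2 hv, v * γ, hθL _ hvγ, by simp⟩
  have hsum : ∀ a : Γ → ℝ, ContMDiff (𝓡 m) 𝓘(ℝ, ℝ) ∞ fun u => ∑ᶠ γ : Γ, a γ * θ (u * γ) := by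
    intro a
    refine contMDiff_finsum (fun γ => contMDiff_const.mul (htrans γ)) fun u => ?_
    obtain ⟨V, hV, hfin⟩ := hlf u
    refine ⟨V, hV, hfin.subset ?_⟩
    rintro γ ⟨v, hv, hvV⟩
    exact ⟨v, hvV, right_ne_zero_of_mul hv⟩
  have hfs : ∀ (u : G) (a : Γ → ℝ), (Function.support fun γ : Γ => a γ * θ (u * γ)).Finite := by
    intro u a
    obtain ⟨V, hV, hfin⟩ := hlf u
    exact hfin.subset fun γ hγ => ⟨u, mem_of_mem_nhds hV, right_ne_zero_of_mul hγ⟩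
  -- `d / s` is the average of `χ γ` with weights `θ (u * γ)`. Replacing `u` by `u * η` reindexes
  -- the sum and subtracts `χ η`, whence the minus sign in the final function.
  let s : G → ℝ := fun u => ∑ᶠ γ : Γ, 1 * θ (u * γ)
  let d : G → ℝ := fun u => ∑ᶠ γ : Γ, (χ γ).toAdd * θ (u * γ)
  have hspos : ∀ u, 0 < s u := by
    intro u
    obtain ⟨k, hk, γ, hγ, rfl⟩ := hKΓ u
    refine finsum_pos (fun η => by simpa using hθ0 _) ⟨⟨γ, hγ⟩⁻¹, by simpa using hθK k hk⟩
      (hfs _ fun _ => 1)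
  have hs : ∀ (u : G) (η : Γ), s (u * η) = s u := fun u η => by
    simp only [s]
    rw [← finsum_comp_equiv (Equiv.mulLeft η) (f := fun γ : Γ => 1 * θ (u * γ))]
    simp [mul_assoc]
  have hd : ∀ (u : G) (η : Γ), d (u * η) = d u - (χ η).toAdd * s u := fun u η => by
    simp only [s, d]
    rw [mul_finsum, ← finsum_sub_distrib (hfs u _)
      ((hfs u fun _ => (χ η).toAdd).subset (by intro γ; simp))]
    conv_rhs => rw [← finsum_comp_equiv (Equiv.mulLeft η)]
    refine finsum_congr fun γ => ?_
    simp only [Equiv.coe_mulLeft, map_mul, toAdd_mul, Subgroup.coe_mul, mul_assoc]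
    ring
  refine ⟨fun u => - (d u / s u), (((hsum _).div₀ (hsum _) fun u => (hspos u).ne')).neg,
    fun u γ => ?_⟩
  simp only [hs, hd]
  have := (hspos u).ne'
  field_simp
  ring

/-! ### Differentiability of homomorphisms to `ℝ` -/

/-- A homomorphism from a Lie group to `ℝ` that is Lipschitz in a chart around `1` is
differentiable. -/
theorem mdifferentiableAt_one_of_lipschitzOnWith {m : ℕ} {G : Type*} [Group G] [TopologicalSpace G]
    [ChartedSpace (EuclideanSpace ℝ (Fin m)) G] [LieGroup (𝓡 m) ∞ G]
    (X : G →* Multiplicative ℝ) {U : Set (EuclideanSpace ℝ (Fin m))}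
    (hU : U ∈ 𝓝 (extChartAt (𝓡 m) (1 : G) 1)) {C : NNReal}
    (hX : LipschitzOnWith C (fun ξ => (X ((extChartAt (𝓡 m) (1 : G)).symm ξ)).toAdd) U) :
    MDifferentiableAt (𝓡 m) 𝓘(ℝ, ℝ) (fun g => (X g).toAdd) (1 : G) := by
  have : IsManifold (𝓡 m) ∞ G := inferInstance
  set ξ₀ := extChartAt (𝓡 m) (1 : G) 1
  have htarget : (extChartAt (𝓡 m) (1 : G)).target ∈ 𝓝 ξ₀ := extChartAt_target_mem_nhds 1
  obtain ⟨O, hOsub, hO, hξO⟩ := mem_nhds_iff.1 (Filter.inter_mem hU htarget)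
  have hlip := hX.mono (fun ξ hξ => (hOsub hξ).1)
  -- Rademacher's theorem on an open set of positive measure yields one point of differentiability;
  -- `X u = X (g * u) - X g` moves it to `1`.
  have hae := hlip.ae_differentiableWithinAt_of_mem (μ := MeasureTheory.volume)
  have hpos : 0 < MeasureTheory.volume O := hO.measure_pos _ ⟨ξ₀, hξO⟩
  obtain ⟨ξ, hξO, hξ⟩ : ∃ ξ ∈ O, DifferentiableWithinAt ℝ
      (fun ξ => (X ((extChartAt (𝓡 m) (1 : G)).symm ξ)).toAdd) O ξ := by
    by_contra hcon
    push Not at hcon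
    refine hpos.ne' (MeasureTheory.measure_mono_null (fun ξ hξ => ?_) hae)
    exact fun h => hcon ξ hξ (h hξ)
  have hdiff := hξ.differentiableAt (hO.mem_nhds hξO)
  set g := (extChartAt (𝓡 m) (1 : G)).symm ξ with hg
  have hgs : g ∈ (extChartAt (𝓡 m) (1 : G)).source :=
    (extChartAt (𝓡 m) (1 : G)).map_target (hOsub hξO).2
  have hgξ : extChartAt (𝓡 m) (1 : G) g = ξ :=
    (extChartAt (𝓡 m) (1 : G)).right_inv (hOsub hξO).2
  have hXg : MDifferentiableAt (𝓡 m) 𝓘(ℝ, ℝ) (fun g => (X g).toAdd) g := by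
    have h1 : MDifferentiableAt (𝓡 m) 𝓘(ℝ, EuclideanSpace ℝ (Fin m)) (extChartAt (𝓡 m) (1 : G)) g :=
      (contMDiffAt_extChartAt' (n := ∞) (by simpa using hgs)).mdifferentiableAt (by simp)
    have h2 := (hgξ ▸ hdiff.mdifferentiableAt :
      MDifferentiableAt 𝓘(ℝ, EuclideanSpace ℝ (Fin m)) 𝓘(ℝ, ℝ)
      (fun ξ => (X ((extChartAt (𝓡 m) (1 : G)).symm ξ)).toAdd) (extChartAt (𝓡 m) (1 : G) g))
    refine (h2.comp g h1).congr_of_eventuallyEq ?_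
    filter_upwards [(isOpen_extChartAt_source (I := 𝓡 m) (1 : G)).mem_nhds hgs] with u hu
    simp only [Function.comp_apply]
    rw [(extChartAt (𝓡 m) (1 : G)).left_inv hu]
  have h3 : MDifferentiableAt (𝓡 m) (𝓡 m) (fun u => g * u) (1 : G) :=
    (contMDiff_mul_left (n := ∞) (a := g)).mdifferentiableAt (by simp)
  have h4 : MDifferentiableAt (𝓡 m) 𝓘(ℝ, ℝ) (fun g => (X g).toAdd) ((fun u => g * u) 1) := by
    simpa using hXg
  have h5 := (h4.comp (1 : G) h3).sub
    (mdifferentiableAt_const (I := 𝓡 m) (I' := 𝓘(ℝ, ℝ)) (c := (X g).toAdd))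
  refine h5.congr_of_eventuallyEq (Filter.Eventually.of_forall fun u => ?_)
  simp

/-- For a smooth function `c` on a Lie group, the functions `v ↦ c (v * u)` are, in a chart around
`1`, uniformly Lipschitz for `u` in a compact set. -/
theorem exists_lipschitz_translates {m : ℕ} {G : Type*} [Group G] [TopologicalSpace G]
    [ChartedSpace (EuclideanSpace ℝ (Fin m)) G] [LieGroup (𝓡 m) ∞ G]
    {c : G → ℝ} (hc : ContMDiff (𝓡 m) 𝓘(ℝ, ℝ) ∞ c) {K : Set G} (hK : IsCompact K) :
    ∃ U ∈ 𝓝 (extChartAt (𝓡 m) (1 : G) 1), ∃ C : NNReal, ∀ ξ ∈ U, ∀ η ∈ U, ∀ u ∈ K,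
      |c ((extChartAt (𝓡 m) (1 : G)).symm ξ * u) - c ((extChartAt (𝓡 m) (1 : G)).symm η * u)| ≤
        C * dist ξ η := by
  have : IsManifold (𝓡 m) ∞ G := inferInstance
  refine hK.induction_on (p := fun s => ∃ U ∈ 𝓝 (extChartAt (𝓡 m) (1 : G) 1), ∃ C : NNReal,
    ∀ ξ ∈ U, ∀ η ∈ U, ∀ u ∈ s, |c ((extChartAt (𝓡 m) (1 : G)).symm ξ * u) -
      c ((extChartAt (𝓡 m) (1 : G)).symm η * u)| ≤ C * dist ξ η) ?_ ?_ ?_ ?_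
  · exact ⟨Set.univ, Filter.univ_mem, 0, by simp⟩
  · rintro s t hst ⟨U, hU, C, h⟩
    exact ⟨U, hU, C, fun ξ hξ η hη u hu => h ξ hξ η hη u (hst hu)⟩
  · rintro s t ⟨U, hU, C, h⟩ ⟨V, hV, D, h'⟩
    refine ⟨U ∩ V, Filter.inter_mem hU hV, max C D, fun ξ hξ η hη u hu => ?_⟩
    rcases hu with hu | hu
    · refine (h ξ hξ.1 η hη.1 u hu).trans ?_
      gcongr; exact le_max_left _ _
    · refine (h' ξ hξ.2 η hη.2 u hu).trans ?_
      gcongr; exact le_max_right _ _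
  · intro k _
    have h1 : ∀ g : G, ContMDiffAt 𝓘(ℝ, EuclideanSpace ℝ (Fin m)) (𝓡 m) ∞
        (extChartAt (𝓡 m) g).symm (extChartAt (𝓡 m) g g) := fun g =>
      (contMDiffOn_extChartAt_symm g).contMDiffAt (extChartAt_target_mem_nhds g)
    have h2 : ContMDiffAt 𝓘(ℝ, EuclideanSpace ℝ (Fin m) × EuclideanSpace ℝ (Fin m)) 𝓘(ℝ, ℝ) ∞
        (fun z : EuclideanSpace ℝ (Fin m) × EuclideanSpace ℝ (Fin m) =>
          c ((extChartAt (𝓡 m) (1 : G)).symm z.1 * (extChartAt (𝓡 m) k).symm z.2))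
        (extChartAt (𝓡 m) (1 : G) 1, extChartAt (𝓡 m) k k) := by
      refine (hc _).comp _ (ContMDiffAt.mul ?_ ?_)
      · exact ContMDiffAt.comp _ (h1 1) contDiff_fst.contMDiff.contMDiffAt
      · exact ContMDiffAt.comp _ (h1 k) contDiff_snd.contMDiff.contMDiffAt
    have h3 := (contMDiffAt_iff_contDiffAt.1 h2).of_le (m := 1) (by simp)
    obtain ⟨C, t, ht, hlip⟩ := h3.exists_lipschitzOnWith
    rw [nhds_prod_eq] at ht
    obtain ⟨U, hU, V, hV, hUV⟩ := Filter.mem_prod_iff.1 ht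
    refine ⟨(extChartAt (𝓡 m) k).source ∩ extChartAt (𝓡 m) k ⁻¹' V,
      mem_nhdsWithin_of_mem_nhds (Filter.inter_mem (extChartAt_source_mem_nhds k)
      ((continuousAt_extChartAt k) hV)), U, hU, C, ?_⟩
    rintro ξ hξ η hη u ⟨hus, huV⟩
    have := hlip.dist_le_mul (ξ, extChartAt (𝓡 m) k u) (hUV ⟨hξ, huV⟩)
      (η, extChartAt (𝓡 m) k u) (hUV ⟨hη, huV⟩)
    simp only [Real.dist_eq, Prod.dist_eq, (extChartAt (𝓡 m) k).left_inv hus, dist_self] at this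
    rwa [max_eq_left dist_nonneg] at this

/-- A homomorphism `χ` from a discrete cocompact subgroup `Γ` of a nilpotent Lie group to `ℝ`
determines a differentiable homomorphism `X` of the Lie group, which is invariant under all
endomorphisms that preserve `Γ` and `χ`, and is nontrivial if `χ` is. -/
theorem exists_hom_real_mdifferentiableAt {m : ℕ} {G : Type*} [Group G] [TopologicalSpace G]
    [ChartedSpace (EuclideanSpace ℝ (Fin m)) G] [LieGroup (𝓡 m) ∞ G] [T2Space G]
    [Group.IsNilpotent G] (Γ : Subgroup G) [DiscreteTopology Γ] [CompactSpace (G ⧸ Γ)]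
    (χ : Γ →* Multiplicative ℝ) :
    ∃ X : G →* Multiplicative ℝ,
      MDifferentiableAt (𝓡 m) 𝓘(ℝ, ℝ) (fun g => (X g).toAdd) (1 : G) ∧
      (X = 1 → χ = 1) ∧
      ∀ B : G →* G, Continuous B → ∀ hB : ∀ γ : Γ, B γ ∈ Γ,
        (∀ γ : Γ, χ ⟨B γ, hB γ⟩ = χ γ) → ∀ g, X (B g) = X g := by
  have : IsTopologicalGroup G := topologicalGroup_of_lieGroup (𝓡 m) ∞
  have : LocallyCompactSpace G := Manifold.locallyCompact_of_finiteDimensional (𝓡 m)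
  obtain ⟨c, hcs, hc⟩ := exists_contMDiff_equivariant (m := m) Γ χ
  obtain ⟨X, ⟨C, hC⟩, hmod⟩ := exists_hom_real_bounded_sub Γ χ c hcs.continuous hc
  obtain ⟨K, hK, hKΓ⟩ := Γ.exists_isCompact_mul_eq
  refine ⟨X, ?_, ?_, ?_⟩
  · obtain ⟨U, hU, D, hD⟩ := exists_lipschitz_translates hcs hK
    refine mdifferentiableAt_one_of_lipschitzOnWith X hU (C := D) ?_
    refine LipschitzOnWith.of_dist_le_mul fun ξ hξ η hη => ?_
    rw [Real.dist_eq]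
    -- The Lipschitz bound for translates of `c` passes to `X`; equivariance reduces all `u` to the
    -- compact set `K`.
    refine hmod _ _ _ fun u => ?_
    obtain ⟨k, hk, γ, hγ, rfl⟩ := hKΓ u
    have h1 := hc ((extChartAt (𝓡 m) (1 : G)).symm ξ * k) ⟨γ, hγ⟩
    have h2 := hc ((extChartAt (𝓡 m) (1 : G)).symm η * k) ⟨γ, hγ⟩
    simp only [mul_assoc] at h1 h2
    rw [h1, h2, add_sub_add_right_eq_sub]
    exact hD ξ hξ η hη k hk
  · rintro rfl
    refine hom_real_eq_one_of_bounded χ (C := C) fun γ => ?_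
    have h1 := hC γ 1
    have h2 := hc 1 γ
    rw [one_mul] at h2
    rw [mul_one, h2] at h1
    simpa using h1
  · intro B hBc hB hχ
    -- As `χ` is `B`-invariant, `c ∘ B - c` is right `Γ`-invariant, hence bounded by its values on
    -- `K`. Then `X ∘ B` and `X` are at bounded distance and must coincide.
    obtain ⟨D, hD⟩ : ∃ D, ∀ u, |c (B u) - c u| ≤ D := by
      obtain ⟨D, hD⟩ := hK.exists_bound_of_continuousOn (f := fun u => c (B u) - c u)
        ((hcs.continuous.comp hBc).sub hcs.continuous).continuousOn
      refine ⟨D, fun u => ?_⟩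
      obtain ⟨k, hk, γ, hγ, rfl⟩ := hKΓ u
      have h1 := hc (B k) ⟨B γ, hB ⟨γ, hγ⟩⟩
      have h2 := hc k ⟨γ, hγ⟩
      rw [hχ ⟨γ, hγ⟩] at h1
      simp only at h1 h2
      rw [map_mul, h1, h2, add_sub_add_right_eq_sub]
      exact hD k hk
    have hone : X.comp B / X = 1 := by
      refine hom_real_eq_one_of_bounded _ (C := 2 * C + 2 * D) fun v => ?_
      have h1 := hC (B v) (B 1)
      have h2 := hC v 1
      rw [← map_mul] at h1
      have h3 := hD (v * 1)
      have h4 := hD 1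
      have h5 : ((X.comp B / X) v).toAdd = (X (B v)).toAdd - (X v).toAdd := rfl
      rw [h5]
      rw [abs_le] at *
      constructor <;> linarith [h1.1, h1.2, h2.1, h2.2, h3.1, h3.2, h4.1, h4.2]
    intro g
    have := DFunLike.congr_fun hone g
    exact div_eq_one.1 this

/-! ### Homomorphisms invariant under a hyperbolic automorphism -/

section Hyperbolic

variable {V : Type*} [AddCommGroup V] [Module ℝ V] [FiniteDimensional ℝ V]

/-- A linear functional vanishes on a subspace on which it is invariant under passing from each
nonzero vector to some shorter vector. -/
theorem linearForm_eq_zero_of_shortening (g : V →ₗ[ℝ] V →ₗ[ℝ] ℝ) (hsymm : ∀ v w, g v w = g w v)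
    (hpos : ∀ v, v ≠ 0 → 0 < g v v) (S : Submodule ℝ V) (l : V →ₗ[ℝ] ℝ)
    (h : ∀ w ∈ S, w ≠ 0 → ∃ u ∈ S, l u = l w ∧ g u u < g w w) : ∀ v ∈ S, l v = 0 := by
  -- Riesz representation on `S`. The representing vector `w` is the shortest vector on which `l`
  -- takes the value `l w`, so the hypothesis forces `w = 0`.
  let R : S →ₗ[ℝ] Module.Dual ℝ S := g.domRestrict₁₂ S S
  have hR : ∀ w v : S, R w v = g w v := fun w v => rfl
  have hinj : Function.Injective R := by
    rw [← LinearMap.ker_eq_bot, LinearMap.ker_eq_bot']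
    intro w hw
    by_contra hne
    have h1 := hpos w (by simpa using hne)
    have h2 : R w w = 0 := by rw [hw]; rfl
    rw [hR] at h2
    exact h1.ne' h2
  have hsurj : Function.Surjective R :=
    (LinearMap.injective_iff_surjective_of_finrank_eq_finrank
      (Subspace.dual_finrank_eq (K := ℝ) (V := S)).symm).1 hinj
  obtain ⟨w, hw⟩ := hsurj (l.domRestrict S)
  have hwl : ∀ v ∈ S, g w v = l v := fun v hv => DFunLike.congr_fun hw ⟨v, hv⟩
  have hw0 : (w : V) = 0 := by
    by_contra hne
    obtain ⟨u, hu, hlu, hlt⟩ := h w w.2 hne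
    have h1 : g w u = g w w := by rw [hwl u hu, hwl w w.2, hlu]
    have h2 : 0 ≤ g (w - u) (w - u) := by
      by_cases h0 : (w : V) - u = 0
      · rw [h0]; simp
      · exact (hpos _ h0).le
    simp only [map_sub, LinearMap.sub_apply] at h2
    rw [hsymm u w, h1] at h2
    linarith
  intro v hv
  rw [← hwl v hv, hw0]; simp

/-- A linear functional that is invariant under a power of a hyperbolic linear map vanishes. -/
theorem linearForm_eq_zero_of_hyperbolic (g : V →ₗ[ℝ] V →ₗ[ℝ] ℝ) (hsymm : ∀ v w, g v w = g w v)
    (hpos : ∀ v, v ≠ 0 → 0 < g v v) (L : V →ₗ[ℝ] V) {Es Eu : Submodule ℝ V}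
    (hE : IsCompl Es Eu) (hs : Es.map L = Es) (hu : Eu.map L = Eu) {k : ℕ}
    (hcontr : ∀ v ∈ Es, g v v = 1 → g ((L ^ k) v) ((L ^ k) v) < 1)
    (hexp : ∀ v ∈ Eu, g v v = 1 → 1 < g ((L ^ k) v) ((L ^ k) v)) {j : ℕ} (hj : 1 ≤ j)
    (l : V →ₗ[ℝ] ℝ) (hl : ∀ v, l ((L ^ j) v) = l v) : l = 0 := by
  have hscale : ∀ v, v ≠ 0 → ∃ r : ℝ, 0 < r ∧ g (r • v) (r • v) = 1 ∧ r * r * g v v = 1 := by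
    intro v hv
    have h := hpos v hv
    have hr : (√(g v v))⁻¹ * (√(g v v))⁻¹ * g v v = 1 := by
      rw [← mul_inv, Real.mul_self_sqrt h.le]; exact inv_mul_cancel₀ h.ne'
    refine ⟨(√(g v v))⁻¹, inv_pos.2 (Real.sqrt_pos.2 h), ?_, hr⟩
    simp only [map_smul, LinearMap.smul_apply, smul_eq_mul]
    rw [← hr]; ring
  have hmap : ∀ S : Submodule ℝ V, S.map L = S → ∀ i, S.map (L ^ i) = S := by
    intro S hS i
    induction i with
    | zero => exact Submodule.map_id S
    | succ i ih => rw [pow_succ', Module.End.mul_eq_comp, Submodule.map_comp, ih, hS]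
  have hcontr' : ∀ v ∈ Es, v ≠ 0 → g ((L ^ k) v) ((L ^ k) v) < g v v := by
    intro v hv hv0
    obtain ⟨r, hr, h1, h2⟩ := hscale v hv0
    have h3 := hcontr (r • v) (Es.smul_mem r hv) h1
    simp only [map_smul, LinearMap.smul_apply, smul_eq_mul] at h3
    have : r * r * g ((L ^ k) v) ((L ^ k) v) < r * r * g v v := by linarith
    exact lt_of_mul_lt_mul_left this (by positivity)
  have hexp' : ∀ v ∈ Eu, v ≠ 0 → g v v < g ((L ^ k) v) ((L ^ k) v) := by
    intro v hv hv0
    obtain ⟨r, hr, h1, h2⟩ := hscale v hv0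
    have h3 := hexp (r • v) (Eu.smul_mem r hv) h1
    simp only [map_smul, LinearMap.smul_apply, smul_eq_mul] at h3
    have : r * r * g v v < r * r * g ((L ^ k) v) ((L ^ k) v) := by linarith
    exact lt_of_mul_lt_mul_left this (by positivity)
  have hmemS : ∀ i, ∀ v ∈ Es, (L ^ i) v ∈ Es := fun i v hv =>
    (hmap Es hs i).le (Submodule.mem_map_of_mem hv)
  have hmemU : ∀ i, ∀ v ∈ Eu, (L ^ i) v ∈ Eu := fun i v hv =>
    (hmap Eu hu i).le (Submodule.mem_map_of_mem hv)
  have hpow : ∀ i v, (L ^ (k * (i + 1))) v = (L ^ k) ((L ^ (k * i)) v) := fun i v => by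
    rw [mul_add, mul_one, add_comm, pow_add]; rfl
  have hs' : ∀ i, ∀ v ∈ Es, v ≠ 0 → g ((L ^ (k * (i + 1))) v) ((L ^ (k * (i + 1))) v) < g v v := by
    intro i v hv hv0
    induction i with
    | zero => simpa using hcontr' v hv hv0
    | succ i ih =>
      rw [hpow]
      by_cases h0 : (L ^ (k * (i + 1))) v = 0
      · rw [h0]; simpa using hpos v hv0
      · exact (hcontr' _ (hmemS _ v hv) h0).trans ih
  have hu' : ∀ i, ∀ v ∈ Eu, v ≠ 0 → g v v < g ((L ^ (k * (i + 1))) v) ((L ^ (k * (i + 1))) v) := by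
    intro i v hv hv0
    induction i with
    | zero => simpa using hexp' v hv hv0
    | succ i ih =>
      rw [hpow]
      have h0 : (L ^ (k * (i + 1))) v ≠ 0 := by
        intro h0
        rw [h0] at ih
        have := hpos v hv0
        simp only [map_zero] at ih
        linarith
      exact ih.trans (hexp' _ (hmemU _ v hv) h0)
  -- Contraction is known for `L ^ k` and invariance for `L ^ j`; the exponent `k * j` serves both.
  obtain ⟨i, rfl⟩ : ∃ i, j = i + 1 := ⟨j - 1, by omega⟩
  have hl' : ∀ v, l ((L ^ (k * (i + 1))) v) = l v := by
    have : ∀ n v, l ((L ^ ((i + 1) * n)) v) = l v := by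
      intro n v
      induction n with
      | zero => simp
      | succ n ih =>
        rw [mul_add, mul_one, add_comm, pow_add, Module.End.mul_apply, hl, ih]
    intro v; rw [mul_comm]; exact this k v
  have h1 := linearForm_eq_zero_of_shortening g hsymm hpos Es l fun w hw hw0 =>
    ⟨_, hmemS _ w hw, hl' w, hs' i w hw hw0⟩
  -- On the unstable space a preimage is shorter, where on the stable space the image was.
  have h2 := linearForm_eq_zero_of_shortening g hsymm hpos Eu l fun w hw hw0 => by
    obtain ⟨u, hu, rfl⟩ := (hmap Eu hu (k * (i + 1))).ge hw
    refine ⟨u, hu, (hl' u).symm, hu' i u hu ?_⟩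
    rintro rfl
    exact hw0 (map_zero _)
  ext v
  have hv : v ∈ Es ⊔ Eu := by rw [hE.sup_eq_top]; trivial
  obtain ⟨a, ha, b, hb, rfl⟩ := Submodule.mem_sup.1 hv
  rw [map_add, h1 a ha, h2 b hb]; simp

end Hyperbolic

/-- A differentiable function that is invariant near a fixed point of an Anosov diffeomorphism
under some power of it has zero derivative at the fixed point. -/
theorem IsAnosov.hasMFDerivAt_zero_of_invariant {m : ℕ} {M : Type*} [TopologicalSpace M]
    [ChartedSpace (EuclideanSpace ℝ (Fin m)) M] [IsManifold (𝓡 m) ∞ M] {f : M → M}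
    (hf : IsAnosov (m := m) f) {x₀ : M} (hfd : MDifferentiableAt (𝓡 m) (𝓡 m) f x₀)
    (hfix : f x₀ = x₀) {j : ℕ} (hj : 1 ≤ j) {Y : M → ℝ}
    (hY : MDifferentiableAt (𝓡 m) 𝓘(ℝ, ℝ) Y x₀) (hYf : ∀ᶠ x in 𝓝 x₀, Y (f^[j] x) = Y x) :
    HasMFDerivAt (𝓡 m) 𝓘(ℝ, ℝ) Y x₀ 0 := by
  let E := EuclideanSpace ℝ (Fin m)
  let L : E →L[ℝ] E := mfderiv (𝓡 m) (𝓡 m) f x₀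
  have hL : HasMFDerivAt (𝓡 m) (𝓡 m) f x₀ L := hfd.hasMFDerivAt
  have hfixi : ∀ i, f^[i] x₀ = x₀ := fun i => Function.iterate_fixed hfix i
  have hiter : ∀ i, HasMFDerivAt (𝓡 m) (𝓡 m) (f^[i]) x₀ (L ^ i : E →L[ℝ] E) := by
    intro i
    induction i with
    | zero => exact hasMFDerivAt_id x₀
    | succ i ih =>
      rw [Function.iterate_succ', pow_succ']
      have h1 : HasMFDerivAt (𝓡 m) (𝓡 m) f (f^[i] x₀) L := by rw [hfixi]; exact hL
      exact h1.comp x₀ ih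
  let l : E →L[ℝ] ℝ := mfderiv (𝓡 m) 𝓘(ℝ, ℝ) Y x₀
  have hl : HasMFDerivAt (𝓡 m) 𝓘(ℝ, ℝ) Y x₀ l := hY.hasMFDerivAt
  have hlj : ∀ v, l ((L ^ j) v) = l v := by
    have h1 : HasMFDerivAt (𝓡 m) 𝓘(ℝ, ℝ) Y (f^[j] x₀) l := by rw [hfixi]; exact hl
    have h2 := (h1.comp x₀ (hiter j)).congr_of_eventuallyEq
      (hYf.mono fun x hx => hx.symm)
    have h3 := hasMFDerivAt_unique h2 hl
    intro v
    exact DFunLike.congr_fun h3 v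
  obtain ⟨g, Es, Eu, hE, -, -, hs, hu, k, -, hk⟩ := hf
  -- The iterates of `x₀` equal `x₀` only propositionally; these identities transfer the metric and
  -- the splitting to the fiber at `x₀`.
  have hinner : ∀ y, y = x₀ → ∀ v w : E, g.inner y v w = g.inner x₀ v w := by rintro _ rfl _ _; rfl
  have hEs : ∀ y, y = x₀ → (Es y : Submodule ℝ E) = Es x₀ := by rintro _ rfl; rfl
  have hEu : ∀ y, y = x₀ → (Eu y : Submodule ℝ E) = Eu x₀ := by rintro _ rfl; rfl
  let g₀ : E →L[ℝ] E →L[ℝ] ℝ := g.inner x₀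
  let b : E →ₗ[ℝ] E →ₗ[ℝ] ℝ := LinearMap.mk₂ ℝ (fun v w => g₀ v w) (by simp) (by simp) (by simp)
    (by simp)
  have hb : ∀ v w : E, b v w = g.inner x₀ v w := fun v w => rfl
  have hLk : (mfderiv (𝓡 m) (𝓡 m) (f^[k]) x₀ : E →L[ℝ] E) = L ^ k := (hiter k).mfderiv
  have hpowc : ∀ (i : ℕ) (v : E), ((L : E →ₗ[ℝ] E) ^ i) v = (L ^ i) v := by
    intro i v
    induction i with
    | zero => rfl
    | succ i ih => rw [pow_succ', pow_succ', Module.End.mul_apply, ih]; rfl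
  have hzero : (l : E →ₗ[ℝ] ℝ) = 0 := by
    refine linearForm_eq_zero_of_hyperbolic b (fun v w => g.symm x₀ v w)
      (fun v hv => g.pos x₀ v hv) (L : E →ₗ[ℝ] E) (hE x₀) ((hs x₀).trans (hEs _ hfix))
      ((hu x₀).trans (hEu _ hfix)) (k := k) ?_ ?_ hj (l : E →ₗ[ℝ] ℝ) ?_
    · intro v hv hv1
      have h1 := (hk x₀).1 v hv hv1
      have h2 := hinner _ (hfixi k) (mfderiv (𝓡 m) (𝓡 m) (f^[k]) x₀ v)
        (mfderiv (𝓡 m) (𝓡 m) (f^[k]) x₀ v)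
      rw [hb, hpowc, ← hLk]
      exact h2 ▸ h1
    · intro v hv hv1
      have h1 := (hk x₀).2 v hv hv1
      have h2 := hinner _ (hfixi k) (mfderiv (𝓡 m) (𝓡 m) (f^[k]) x₀ v)
        (mfderiv (𝓡 m) (𝓡 m) (f^[k]) x₀ v)
      rw [hb, hpowc, ← hLk]
      exact h2 ▸ h1
    · intro v
      rw [hpowc]; exact hlj v
  have hl0 : l = 0 := ContinuousLinearMap.coe_injective hzero
  rw [hl0] at hl
  exact hl

/-- A homomorphism from a connected Lie group to `ℝ` whose derivative at `1` vanishes is trivial. -/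
theorem hom_real_eq_one_of_hasMFDerivAt_zero {m : ℕ} {G : Type*} [Group G] [TopologicalSpace G]
    [ChartedSpace (EuclideanSpace ℝ (Fin m)) G] [LieGroup (𝓡 m) ∞ G] [ConnectedSpace G]
    (X : G →* Multiplicative ℝ)
    (hX : HasMFDerivAt (𝓡 m) 𝓘(ℝ, ℝ) (fun g => (X g).toAdd) (1 : G) 0) : X = 1 := by
  have : IsTopologicalGroup G := topologicalGroup_of_lieGroup (𝓡 m) ∞
  have : IsManifold (𝓡 m) ∞ G := inferInstance
  -- `X u = X (g⁻¹ * u) + X g` spreads the vanishing derivative from `1` to every point; then `X` is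
  -- constant in a chart ball.
  have hall : ∀ g, HasMFDerivAt (𝓡 m) 𝓘(ℝ, ℝ) (fun g => (X g).toAdd) g 0 := by
    intro g
    have h3 : MDifferentiableAt (𝓡 m) (𝓡 m) (fun u => g⁻¹ * u) g :=
      (contMDiff_mul_left (n := ∞) (a := g⁻¹)).mdifferentiableAt (by simp)
    have h4 : HasMFDerivAt (𝓡 m) 𝓘(ℝ, ℝ) (fun g => (X g).toAdd) ((fun u => g⁻¹ * u) g) 0 := by
      have h : ∀ u, u = 1 → HasMFDerivAt (𝓡 m) 𝓘(ℝ, ℝ) (fun g => (X g).toAdd) u 0 := by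
        rintro _ rfl; exact hX
      exact h _ (inv_mul_cancel g)
    have h5 := h4.comp g h3.hasMFDerivAt
    have h6 := h5.add (hasMFDerivAt_const (I := 𝓡 m) (I' := 𝓘(ℝ, ℝ)) (X g).toAdd g)
    have h7 := h6.congr_of_eventuallyEq (f₁ := fun g => (X g).toAdd)
      (Filter.Eventually.of_forall fun u => by simp)
    exact h7.congr_mfderiv ((add_zero _).trans (ContinuousLinearMap.zero_comp _))
  set e := extChartAt (𝓡 m) (1 : G)
  have htarget : e.target ∈ 𝓝 (e 1) := extChartAt_target_mem_nhds 1
  obtain ⟨r, hr, hball⟩ := Metric.mem_nhds_iff.1 htarget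
  have hd : ∀ ξ ∈ Metric.ball (e 1) r, HasFDerivAt (fun ξ => (X (e.symm ξ)).toAdd)
      (0 : EuclideanSpace ℝ (Fin m) →L[ℝ] ℝ) ξ := by
    intro ξ hξ
    have h1 : MDifferentiableAt 𝓘(ℝ, EuclideanSpace ℝ (Fin m)) (𝓡 m) e.symm ξ :=
      ((contMDiffOn_extChartAt_symm (n := ∞) (1 : G)).contMDiffAt
        (Filter.mem_of_superset (Metric.isOpen_ball.mem_nhds hξ) hball)).mdifferentiableAt (by simp)
    have h2 := (hall (e.symm ξ)).comp ξ h1.hasMFDerivAt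
    rw [hasMFDerivAt_iff_hasFDerivAt] at h2
    convert! h2 using 1
  have hconst : ∀ ξ ∈ Metric.ball (e 1) r, (X (e.symm ξ)).toAdd = 0 := by
    intro ξ hξ
    have := Metric.isOpen_ball.is_const_of_fderiv_eq_zero (𝕜 := ℝ)
      (convex_ball (e 1) r).isPreconnected
      (fun ξ hξ => (hd ξ hξ).differentiableAt.differentiableWithinAt)
      (fun ξ hξ => (hd ξ hξ).fderiv) hξ (Metric.mem_ball_self hr)
    rw [this, extChartAt_to_inv]; simp
  -- A subgroup containing a neighborhood of `1` is open and closed, so here it is everything.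
  have hnhds : (X.ker : Set G) ∈ 𝓝 (1 : G) := by
    filter_upwards [extChartAt_source_mem_nhds (I := 𝓡 m) (1 : G),
      continuousAt_extChartAt (I := 𝓡 m) (1 : G) (Metric.ball_mem_nhds (e 1) hr)] with u hu hu'
    have h := hconst (e u) hu'
    rw [e.left_inv hu] at h
    exact h
  have hopen := Subgroup.isOpen_of_mem_nhds _ hnhds
  have htop : (X.ker : Set G) = Set.univ :=
    IsClopen.eq_univ ⟨X.ker.isClosed_of_isOpen hopen, hopen⟩ ⟨1, one_mem _⟩
  ext g
  have hg : g ∈ (X.ker : Set G) := by rw [htop]; trivial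
  exact hg

/-- Let `p' : G → M` be a local diffeomorphism at `1` that conjugates an endomorphism `B` of the
connected Lie group `G` to a power of an Anosov diffeomorphism of `M`. Then `B` preserves no
nontrivial differentiable homomorphism to `ℝ`. -/
theorem IsAnosov.hom_real_eq_one {m : ℕ} {M : Type*} [TopologicalSpace M]
    [ChartedSpace (EuclideanSpace ℝ (Fin m)) M] [IsManifold (𝓡 m) ∞ M] {f : M → M}
    (hf : IsAnosov (m := m) f) (hfd : ContMDiff (𝓡 m) (𝓡 m) ∞ f)
    {G : Type*} [Group G] [TopologicalSpace G]
    [ChartedSpace (EuclideanSpace ℝ (Fin m)) G] [LieGroup (𝓡 m) ∞ G] [ConnectedSpace G]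
    {p' : G → M} (hp' : IsLocalDiffeomorphAt (𝓡 m) (𝓡 m) ∞ p' 1) (hfix : f (p' 1) = p' 1)
    (B : G →* G) (hB : Continuous B) {j : ℕ} (hj : 1 ≤ j) (hconj : ∀ u, f^[j] (p' u) = p' (B u))
    (X : G →* Multiplicative ℝ)
    (hX : MDifferentiableAt (𝓡 m) 𝓘(ℝ, ℝ) (fun g => (X g).toAdd) (1 : G))
    (hXB : ∀ g, X (B g) = X g) : X = 1 := by
  have : IsManifold (𝓡 m) ∞ G := inferInstance
  refine hom_real_eq_one_of_hasMFDerivAt_zero (m := m) X ?_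
  set s := hp'.localInverse with hs
  have hsd : MDifferentiableAt (𝓡 m) (𝓡 m) s (p' 1) :=
    hp'.localInverse_mdifferentiableAt (by simp)
  have hs1 : s (p' 1) = 1 := hp'.localInverse_left_inv hp'.localInverse_mem_target
  have hleft : ∀ᶠ u in 𝓝 (1 : G), s (p' u) = u := hp'.localInverse_eventuallyEq_left
  have hright : ∀ᶠ x in 𝓝 (p' 1), p' (s x) = x := hp'.localInverse_eventuallyEq_right
  have hX' : MDifferentiableAt (𝓡 m) 𝓘(ℝ, ℝ) (fun g => (X g).toAdd) (s (p' 1)) := by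
    rw [hs1]; exact hX
  -- `X` is pushed down to a function near `p' 1` by the local inverse `s`. Near the fixed point `s`
  -- conjugates `f^[j]` back to `B`, so this function is `f^[j]`-invariant.
  have hY := hX'.comp (p' 1) hsd
  have hBs : Filter.Tendsto (fun x => B (s x)) (𝓝 (p' 1)) (𝓝 1) := by
    have := (hB.tendsto (s (p' 1))).comp hsd.continuousAt
    rwa [hs1, map_one] at this
  have hYf : ∀ᶠ x in 𝓝 (p' 1), ((fun g => (X g).toAdd) ∘ s) (f^[j] x) =
      ((fun g => (X g).toAdd) ∘ s) x := by
    filter_upwards [hright, hBs.eventually hleft] with x h1 h2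
    simp only [Function.comp_apply]
    rw [← h1, hconj, h2, hXB, h1]
  have h0 := hf.hasMFDerivAt_zero_of_invariant (hfd.mdifferentiableAt (by simp)) hfix hj hY hYf
  have h1 := h0.comp (1 : G) (hp'.mdifferentiableAt (by simp)).hasMFDerivAt
  have h2 := h1.congr_of_eventuallyEq (f₁ := fun g => (X g).toAdd)
    (hleft.mono fun u hu => by simp only [Function.comp_apply]; rw [hu])
  convert! h2 using 1

/-! ### Monodromy -/

/-- Monodromy is natural with respect to maps of covering spaces. -/
theorem IsCoveringMap.monodromy_natural {E X E' X' : Type*} [TopologicalSpace E]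
    [TopologicalSpace X] [TopologicalSpace E'] [TopologicalSpace X'] {p : E → X} {p' : E' → X'}
    (hp : IsCoveringMap p) (hp' : IsCoveringMap p') (F' : C(E, E')) (F : C(X, X'))
    (hF : ∀ e, p' (F' e) = F (p e)) {x y : X} (σ : Path.Homotopic.Quotient x y) (e : p ⁻¹' {x}) :
    (hp'.monodromy (σ.map F) ⟨F' e, by simp [hF, show p e = x from e.2]⟩ : E') =
      F' (hp.monodromy σ e) := by
  obtain ⟨e, rfl⟩ := e
  obtain ⟨σ⟩ := σ
  change hp'.liftPath _ _ _ 1 = F' (hp.liftPath _ _ _ 1)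
  -- Uniqueness of path lifting: `F'` applied to the lift of `σ` lifts the image of `σ`.
  rw [← (hp'.eq_liftPath_iff' _ (Γ := F'.comp (hp.liftPath σ e σ.source))).2 ⟨?_, ?_⟩]
  · rfl
  · ext t
    have := congrFun (hp.liftPath_lifts (σ : C(unitInterval, X)) e σ.source) t
    simp only [Function.comp_apply, ContinuousMap.comp_apply, hF] at this ⊢
    rw [this]; rfl
  · simp [hp.liftPath_zero]

/-- Monodromy is natural with respect to maps of covering spaces that preserve a base point. -/
theorem IsCoveringMap.monodromy_mapOfEq {E X E' X' : Type*} [TopologicalSpace E]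
    [TopologicalSpace X] [TopologicalSpace E'] [TopologicalSpace X'] {p : E → X} {p' : E' → X'}
    (hp : IsCoveringMap p) (hp' : IsCoveringMap p') (F' : C(E, E')) (F : C(X, X'))
    (hF : ∀ e, p' (F' e) = F (p e)) {x : X} {y : X'} (hxy : F x = y) (σ : FundamentalGroup X x)
    (e : p ⁻¹' {x}) (e' : p' ⁻¹' {y}) (he : F' e = e') :
    (hp'.monodromy (FundamentalGroup.mapOfEq F hxy σ) e' : E') = F' (hp.monodromy σ e) := by
  subst hxy
  obtain rfl : e' = ⟨F' e, by simp [hF, show p e = x from e.2]⟩ := Subtype.ext he.symm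
  rw [FundamentalGroup.mapOfEq_apply, Path.Homotopic.Quotient.cast_rfl_rfl]
  exact hp.monodromy_natural hp' F' F hF σ e

theorem FundamentalGroup.mapOfEq_mapOfEq {X Y Z : Type*} [TopologicalSpace X] [TopologicalSpace Y]
    [TopologicalSpace Z] (f : C(X, Y)) (g : C(Y, Z)) {x : X} {y : Y} {z : Z} (hf : f x = y)
    (hg : g y = z) (σ : FundamentalGroup X x) :
    mapOfEq g hg (mapOfEq f hf σ) = mapOfEq (g.comp f) (by simp [hf, hg]) σ := by
  subst hf
  subst hg
  simp only [mapOfEq_apply]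
  obtain ⟨σ⟩ := σ
  rfl

/-- Functoriality for a commutative square whose base points match only propositionally; it is used
to compare the endomorphism of the nilmanifold with `α` on `M`. -/
theorem FundamentalGroup.mapOfEq_comm {X Y Y' Z : Type*} [TopologicalSpace X] [TopologicalSpace Y]
    [TopologicalSpace Y'] [TopologicalSpace Z] {f : C(X, Y)} {g : C(Y, Z)} {f' : C(X, Y')}
    {g' : C(Y', Z)} (h : g.comp f = g'.comp f') {x : X} {y : Y} {y' : Y'} {z : Z} (hf : f x = y)
    (hg : g y = z) (hf' : f' x = y') (hg' : g' y' = z) (σ : FundamentalGroup X x) :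
    mapOfEq g hg (mapOfEq f hf σ) = mapOfEq g' hg' (mapOfEq f' hf' σ) := by
  have key : ∀ (u v : C(X, Z)) (hu : u x = z) (hv : v x = z), u = v →
      mapOfEq u hu σ = mapOfEq v hv σ := by
    rintro u _ hu hv rfl; rfl
  rw [mapOfEq_mapOfEq, mapOfEq_mapOfEq]
  exact key _ _ _ _ h

/-- The image of the fundamental group of a covering space with finite fiber has finite index. -/
theorem IsCoveringMap.finiteIndex_range_mapOfEq {E X : Type*} [TopologicalSpace E]
    [TopologicalSpace X] {p : E → X} (hp : IsCoveringMap p) {x : X} {e : E} (he : p e = x)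
    (hfin : (p ⁻¹' {x}).Finite) :
    (FundamentalGroup.mapOfEq (⟨p, hp.continuous⟩ : C(E, X)) he).range.FiniteIndex := by
  let _ := hp.fundamentalGroupMulAction x
  have : Finite (p ⁻¹' {x}) := hfin
  let e' : p ⁻¹' {x} := ⟨e, he⟩
  -- Orbit–stabilizer for the monodromy action on the finite fiber. A class fixing `e` lifts to a
  -- loop at `e`, hence lies in the image.
  have hst : (MulAction.stabilizer (FundamentalGroup X x) e').FiniteIndex := by
    rw [Subgroup.finiteIndex_iff_finite_quotient]
    exact Finite.of_equiv _ (MulAction.orbitEquivQuotientStabilizer (FundamentalGroup X x) e')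
  refine Subgroup.finiteIndex_of_le (H := MulAction.stabilizer (FundamentalGroup X x) e') ?_
  intro σ hσ
  have hσ : hp.monodromy σ e' = e' := hσ
  refine ⟨(hp.liftPathQuotient σ e').cast rfl (congrArg Subtype.val hσ.symm), ?_⟩
  rw [FundamentalGroup.mapOfEq_apply, Path.Homotopic.Quotient.map_cast,
    IsCoveringMap.map_liftPathQuotient, Path.Homotopic.Quotient.cast_cast]
  exact (Path.Homotopic.Quotient.cast_cast (X := X) σ _ _ _ _).trans
    (Path.Homotopic.Quotient.cast_rfl_rfl (X := X) σ)

/-! ### Finite index of the displacement subgroup -/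

/-- For an endomorphism of a finitely generated nilpotent group without nontrivial invariant
homomorphisms to `ℝ`, the displacement subgroup has finite index. -/
theorem finiteIndex_displacementSubgroup {P : Type*} [Group P] [Group.IsNilpotent P] [Group.FG P]
    (F : P →* P)
    (hF : ∀ χ : P →* Multiplicative ℝ, (∀ σ, χ (F σ) = χ σ) → χ = 1) :
    (displacementSubgroup fun _ : Unit => F).FiniteIndex := by
  rw [Subgroup.finiteIndex_iff_finite_quotient]
  refine finite_of_isNilpotent_of_hom_real_trivial _ fun f => ?_
  -- Composed with the projection, `f` becomes `F`-invariant because the quotient identifies `F σ`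
  -- with `σ`.
  have h := hF (f.comp (QuotientGroup.mk' _)) fun σ => by
    have : ((F σ * σ⁻¹ : P) : P ⧸ displacementSubgroup fun _ : Unit => F) = 1 :=
      (QuotientGroup.eq_one_iff _).2 (Subgroup.subset_closure ⟨(), σ, rfl⟩)
    rw [QuotientGroup.mk_mul, QuotientGroup.mk_inv, mul_inv_eq_one] at this
    exact congrArg f this
  refine MonoidHom.ext fun x => ?_
  obtain ⟨x, rfl⟩ := QuotientGroup.mk_surjective x
  exact DFunLike.congr_fun h x

/-! ### The displacement subgroup of an affine Anosov action -/

/-- Iterates of affine maps are affine. -/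
theorem exists_affine_iterate {G : Type*} [Group G] [TopologicalSpace G] (Γ : Subgroup G)
    (A : G →* G) (hA : Continuous A) (hΓ : ∀ γ ∈ Γ, A γ ∈ Γ) (g : G) (j : ℕ) :
    ∃ (A' : G →* G) (g' : G), Continuous A' ∧ (∀ γ ∈ Γ, A' γ ∈ Γ) ∧
      ∀ x, (fun x => g * A x)^[j] x = g' * A' x := by
  induction j with
  | zero => exact ⟨MonoidHom.id G, 1, continuous_id, fun γ hγ => hγ, by simp⟩
  | succ j ih =>
    obtain ⟨A', g', hA', hΓ', h⟩ := ih
    refine ⟨A.comp A', g * A g', hA.comp hA', fun γ hγ => hΓ _ (hΓ' γ hγ), fun x => ?_⟩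
    rw [Function.iterate_succ_apply', h]
    simp [mul_assoc]

/-- A lift of an affine automorphism `f` with a fixed point `x₀` can be normalized: after replacing
`f` by a power, it is covered by an automorphism `B` of the Lie group with base point over `x₀`. -/
theorem NilmanifoldCover.exists_conjugate_endomorphism {m : ℕ} {M : Type*} [TopologicalSpace M]
    [ChartedSpace (EuclideanSpace ℝ (Fin m)) M] (C : NilmanifoldCover m M) (A : C.G ≃ₜ* C.G)
    (g : C.G) (hΓ : C.Γ.map (A : C.G →* C.G) = C.Γ) {f : M → M}
    (hf : ∀ x : C.G, f (C.p (x : C.G ⧸ C.Γ)) = C.p ((g * A x : C.G) : C.G ⧸ C.Γ))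
    {x₀ : M} (hfix : f x₀ = x₀) :
    ∃ (j : ℕ) (q₀ : C.G) (B : C.G →* C.G), 1 ≤ j ∧ Continuous B ∧ (∀ γ ∈ C.Γ, B γ ∈ C.Γ) ∧
      C.p (q₀ : C.G ⧸ C.Γ) = x₀ ∧
      ∀ u : C.G, f^[j] (C.p ((q₀ * u : C.G) : C.G ⧸ C.Γ)) = C.p ((q₀ * B u : C.G) : C.G ⧸ C.Γ) := by
  obtain ⟨q, hq⟩ := C.surjective x₀
  obtain ⟨q₀, rfl⟩ := QuotientGroup.mk_surjective q
  let T : C.G → C.G := fun x => g * A x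
  have hAΓ : ∀ γ, A γ ∈ C.Γ ↔ γ ∈ C.Γ := by
    intro γ
    constructor
    · intro h
      rw [← hΓ] at h
      obtain ⟨η, hη, h⟩ := h
      have : η = γ := A.injective h
      exact this ▸ hη
    · intro h
      rw [← hΓ]
      exact ⟨γ, h, rfl⟩
  have hT : ∀ x y : C.G, ((T x : C.G) : C.G ⧸ C.Γ) = (T y : C.G) → (x : C.G ⧸ C.Γ) = y := by
    intro x y h
    rw [QuotientGroup.eq] at h ⊢
    rw [← hAΓ]
    simpa [T, mul_assoc] using h
  have hTi : ∀ (i : ℕ) (x y : C.G), ((T^[i] x : C.G) : C.G ⧸ C.Γ) = (T^[i] y : C.G) →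
      (x : C.G ⧸ C.Γ) = y := by
    intro i
    induction i with
    | zero => intro x y h; exact h
    | succ i ih =>
      intro x y h
      rw [Function.iterate_succ_apply', Function.iterate_succ_apply'] at h
      exact ih x y (hT _ _ h)
  have hfT : ∀ (i : ℕ) (x : C.G), f^[i] (C.p (x : C.G ⧸ C.Γ)) =
      C.p ((T^[i] x : C.G) : C.G ⧸ C.Γ) := by
    intro i x
    induction i with
    | zero => rfl
    | succ i ih => rw [Function.iterate_succ_apply', Function.iterate_succ_apply', ih, hf]
  have hmem : ∀ i : ℕ, ((T^[i] q₀ : C.G) : C.G ⧸ C.Γ) ∈ C.p ⁻¹' {x₀} := by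
    intro i
    rw [Set.mem_preimage, ← hfT, hq]
    exact Function.iterate_fixed hfix i
  -- The orbit of `q₀` stays in the finite fiber over `x₀` and must repeat; since `T` is injective
  -- modulo `Γ`, it returns to `q₀` itself.
  obtain ⟨i, -, i', -, hne, heq⟩ := Set.infinite_univ.exists_ne_map_eq_of_mapsTo
    (f := fun i : ℕ => ((T^[i] q₀ : C.G) : C.G ⧸ C.Γ)) (fun i _ => hmem i) (C.finite_fiber x₀)
  obtain ⟨j, hj, hjq⟩ : ∃ j : ℕ, 1 ≤ j ∧ (q₀ : C.G ⧸ C.Γ) = (T^[j] q₀ : C.G) := by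
    wlog hlt : i < i' generalizing i i'
    · exact this i' i hne.symm heq.symm (by omega)
    refine ⟨i' - i, by omega, hTi i _ _ ?_⟩
    rw [← Function.iterate_add_apply, show i + (i' - i) = i' by omega]
    exact heq
  obtain ⟨A', g', hA', hΓ', hT'⟩ := exists_affine_iterate C.Γ (A : C.G →* C.G) A.continuous
    (fun γ hγ => (hAΓ γ).2 hγ) g j
  rw [QuotientGroup.eq] at hjq
  set γ₀ : C.G := q₀⁻¹ * T^[j] q₀ with hγ₀
  have hq₀ : g' * A' q₀ = q₀ * γ₀ := by
    rw [← hT', hγ₀]; simp [T]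
  -- Since `T^[j] (q₀ * u) = q₀ * γ₀ * A' u` and `γ₀ ∈ Γ`, multiplying by `γ₀⁻¹` on the right
  -- changes nothing modulo `Γ` and turns the affine map into a homomorphism based at `q₀`.
  refine ⟨j, q₀, (MulAut.conj γ₀).toMonoidHom.comp A', hj, ?_, ?_, hq, fun u => ?_⟩
  · have : IsTopologicalGroup C.G := topologicalGroup_of_lieGroup (𝓡 m) ∞
    change Continuous fun u => γ₀ * A' u * γ₀⁻¹
    fun_prop
  · intro γ hγ
    exact mul_mem (mul_mem hjq (hΓ' γ hγ)) (inv_mem hjq)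
  · have h1 : T^[j] (q₀ * u) = q₀ * (γ₀ * A' u) := by
      rw [show T^[j] (q₀ * u) = g' * A' (q₀ * u) from hT' _, map_mul, ← mul_assoc, hq₀, mul_assoc]
    rw [hfT, h1]
    congr 1
    rw [QuotientGroup.eq]
    change (q₀ * (γ₀ * A' u))⁻¹ * (q₀ * (γ₀ * A' u * γ₀⁻¹)) ∈ C.Γ
    simpa [mul_assoc] using hjq

/-- The fundamental group of a nilmanifold is the lattice. -/
theorem exists_fundamentalGroup_mulEquiv {G : Type*} [Group G] [TopologicalSpace G]
    [IsTopologicalGroup G] [SimplyConnectedSpace G] (Γ : Subgroup G) [DiscreteTopology Γ] (q₀ : G) :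
    ∃ (hπ : IsCoveringMap ((↑) : G → G ⧸ Γ)) (ε : FundamentalGroup (G ⧸ Γ) (q₀ : G ⧸ Γ) ≃* Γ),
      ∀ σ, q₀ * (ε σ : G) = hπ.monodromy σ ⟨q₀, rfl⟩ := by
  have hπ := Γ.isQuotientCoveringMap (isDiscrete_iff_discreteTopology.2 inferInstance)
  let e : ((↑) : G → G ⧸ Γ) ⁻¹' {(q₀ : G ⧸ Γ)} := ⟨q₀, rfl⟩
  let θ := hπ.fundamentalGroupEquiv e
  -- The lattice acts by right translations, that is, through `Γ.op`; the second opposite undoes the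
  -- reversal.
  let δ : (Γ.op)ᵐᵒᵖ ≃* Γ :=
    { toFun := fun z => ⟨z.unop.1.unop, z.unop.2⟩
      invFun := fun γ => MulOpposite.op ⟨MulOpposite.op γ.1, γ.2⟩
      left_inv := fun z => rfl
      right_inv := fun γ => rfl
      map_mul' := fun z w => rfl }
  exact ⟨hπ.isCoveringMap, θ.trans δ, fun σ => hπ.unop_fundamentalGroupToMulOpposite_smul (e := e)⟩

/-- The displacement subgroup of an affine action with an Anosov element has finite index. -/
theorem finiteIndex_displacementSubgroup_of_isAnosov {k m : ℕ} {M : Type*} [TopologicalSpace M]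
    [ChartedSpace (EuclideanSpace ℝ (Fin m)) M] [IsManifold (𝓡 m) ∞ M]
    (α : IntLattice k →* Diff (𝓡 m) ∞ M) {a : IntLattice k}
    (hα_affine : IsAffineAutomorphism m (α a).1) (hα_anosov : IsAnosov (m := m) (α a).1)
    {x₀ : M} (hx : ∀ a, (α a).1 x₀ = x₀) :
    (displacementSubgroup (inducedMap α hx)).FiniteIndex := by
  obtain ⟨C, A, g, hΓ, hf⟩ := hα_affine
  obtain ⟨j, q₀, B, hj, hBc, hBΓ, hq₀, hconj⟩ := C.exists_conjugate_endomorphism A g hΓ hf (hx a)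
  have : IsTopologicalGroup C.G := topologicalGroup_of_lieGroup (𝓡 m) ∞
  have : LocallyCompactSpace C.G := Manifold.locallyCompact_of_finiteDimensional (𝓡 m)
  have := C.discrete
  have := C.cocompact
  obtain ⟨hπ, ε, hε⟩ := exists_fundamentalGroup_mulEquiv C.Γ q₀
  -- the endomorphism of the nilmanifold covered by `B`, and its lift
  let F' : C(C.G, C.G) := ⟨fun x => q₀ * B (q₀⁻¹ * x), by fun_prop⟩
  have hF' : ∀ u, F' (q₀ * u) = q₀ * B u := fun u => by simp [F']
  let F : C(C.G ⧸ C.Γ, C.G ⧸ C.Γ) :=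
    ⟨Quotient.lift (fun x => ((F' x : C.G) : C.G ⧸ C.Γ)) (by
      intro x y hxy
      have hxy : x⁻¹ * y ∈ C.Γ := QuotientGroup.leftRel_apply.1 hxy
      rw [QuotientGroup.eq]
      have := hBΓ _ hxy
      simpa [F', mul_assoc] using this),
      Continuous.quotient_lift (by fun_prop) _⟩
  have hF : ∀ x : C.G, ((F' x : C.G) : C.G ⧸ C.Γ) = F (x : C.G ⧸ C.Γ) := fun x => rfl
  have hFq : F (q₀ : C.G ⧸ C.Γ) = q₀ := by
    rw [← hF]; congr 1; simp [F']
  let F₁ := FundamentalGroup.mapOfEq F hFq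
  -- Naturality of monodromy identifies the induced map on the fundamental group with the
  -- restriction of `B` to `Γ`.
  have hεF : ∀ σ, (ε (F₁ σ) : C.G) = B (ε σ) := by
    intro σ
    have h1 := hε (F₁ σ)
    rw [hπ.monodromy_mapOfEq hπ F' F hF hFq σ ⟨q₀, rfl⟩ ⟨q₀, rfl⟩ (by simp [F']), ← hε, hF'] at h1
    exact mul_left_cancel h1
  -- the displacement subgroup of the nilmanifold
  have hfg : Group.FG C.Γ := C.Γ.fg_of_discrete_of_cocompact
  have : Group.FG (FundamentalGroup (C.G ⧸ C.Γ) (q₀ : C.G ⧸ C.Γ)) :=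
    Group.fg_of_surjective ε.symm.surjective (f := ε.symm.toMonoidHom)
  have : Group.IsNilpotent (FundamentalGroup (C.G ⧸ C.Γ) (q₀ : C.G ⧸ C.Γ)) :=
    Group.nilpotent_of_mulEquiv ε.symm
  have hfi : (displacementSubgroup fun _ : Unit => F₁).FiniteIndex := by
    refine finiteIndex_displacementSubgroup F₁ fun χ hχ => ?_
    obtain ⟨X, hXd, hX1, hXB⟩ := exists_hom_real_mdifferentiableAt (m := m) C.Γ
      (χ.comp ε.symm.toMonoidHom)
    have hX : X = 1 := by
      -- Left translation by `q₀` puts the identity of the group over the fixed point `x₀`.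
      let τ : C.G ≃ₘ^∞⟮𝓡 m, 𝓡 m⟯ C.G :=
        { toEquiv := Equiv.mulLeft q₀
          contMDiff_toFun := contMDiff_mul_left
          contMDiff_invFun := contMDiff_mul_left }
      have hloc : IsLocalDiffeomorphAt (𝓡 m) (𝓡 m) ∞
          (fun u : C.G => C.p ((q₀ * u : C.G) : C.G ⧸ C.Γ)) 1 :=
        (τ.isLocalDiffeomorph 1).comp (𝓡 m) M (C.isLocalDiffeomorph _)
      refine hα_anosov.hom_real_eq_one (α a).2.1 hloc ?_ B hBc hj hconj X hXd ?_
      · simp only [mul_one, hq₀, hx]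
      · refine hXB B hBc (fun γ => hBΓ γ γ.2) fun γ => ?_
        have h1 : (⟨B γ, hBΓ γ γ.2⟩ : C.Γ) = ε (F₁ (ε.symm γ)) := Subtype.ext (by simp [hεF])
        rw [h1]
        change χ (ε.symm (ε (F₁ (ε.symm γ)))) = χ (ε.symm γ)
        rw [ε.symm_apply_apply, hχ]
    have h1 := hX1 hX
    refine MonoidHom.ext fun σ => ?_
    have h2 := DFunLike.congr_fun h1 (ε σ)
    change χ (ε.symm (ε σ)) = 1 at h2
    rwa [ε.symm_apply_apply] at h2
  -- push forward to `M`
  let P : C(C.G ⧸ C.Γ, M) := ⟨C.p, C.isCoveringMap.continuous⟩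
  let p₁ := FundamentalGroup.mapOfEq P hq₀
  have hrange : p₁.range.FiniteIndex :=
    C.isCoveringMap.finiteIndex_range_mapOfEq hq₀ (C.finite_fiber x₀)
  -- The index of an image is the index of the subgroup joined with the kernel times the index of
  -- the range; both factors are finite.
  have hmap : ((displacementSubgroup fun _ : Unit => F₁).map p₁).FiniteIndex := by
    constructor
    rw [Subgroup.index_map]
    refine mul_ne_zero ?_ hrange.index_ne_zero
    have := Subgroup.finiteIndex_of_le
      (le_sup_left : (displacementSubgroup fun _ : Unit => F₁) ≤ _ ⊔ p₁.ker)
    exact this.index_ne_zero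
  refine Subgroup.finiteIndex_of_le (H := (displacementSubgroup fun _ : Unit => F₁).map p₁) ?_
  rw [Subgroup.map_le_iff_le_comap, displacementSubgroup, Subgroup.closure_le]
  rintro _ ⟨-, σ, rfl⟩
  -- `B` covers the `j`-th power of `α a`, so the group element `a ^ j` realizes the pushed-forward
  -- generator.
  refine Subgroup.subset_closure ⟨a ^ j, p₁ σ, ?_⟩
  rw [map_mul, map_inv]
  congr 1
  have hcomp : P.comp F = (Diff.toContinuousMap (α (a ^ j))).comp P := by
    ext y
    obtain ⟨y, rfl⟩ := QuotientGroup.mk_surjective y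
    have h1 := hconj (q₀⁻¹ * y)
    rw [mul_inv_cancel_left] at h1
    have h2 : (α (a ^ j)).1 = (α a).1 ^ j := by rw [map_pow]; rfl
    change C.p ((F' y : C.G) : C.G ⧸ C.Γ) = (α (a ^ j)).1 (C.p y)
    rw [h2, Equiv.Perm.coe_pow, h1]
    rfl
  exact FundamentalGroup.mapOfEq_comm hcomp hFq hq₀ hq₀ (hx (a ^ j)) σ

/-! ### Tangent distribution and leafwise maps of a horizontal foliation -/

namespace Foliation

section Charts

variable {E H : Type*} [NormedAddCommGroup E] [NormedSpace ℝ E] [TopologicalSpace H]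
  {I : ModelWithCorners ℝ E H} {n : ℕ∞} {d c : ℕ} {X : Type*} [TopologicalSpace X]
  [ChartedSpace H X]

/-- `γ` is continuous at `t`, and near `t` it runs in the leaf of `γ t`. -/
def LeafwiseAt (W : Foliation I n d c X) {Z : Type*} [TopologicalSpace Z] (γ : Z → X) (t : Z) :
    Prop :=
  ContinuousAt γ t ∧ ∀ φ ∈ W.atlas, γ t ∈ φ.source → ∀ᶠ s in 𝓝 t, (φ (γ s)).2 = (φ (γ t)).2

/-- One chart suffices: plaques of two charts coincide near the point, and continuity keeps `γ` in
the neighborhood where they do. -/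
theorem LeafwiseAt.of_chart {W : Foliation I n d c X} {Z : Type*} [TopologicalSpace Z] {γ : Z → X}
    {t : Z} (hγ : ContinuousAt γ t) {φ} (hφ : φ ∈ W.atlas) (ht : γ t ∈ φ.source)
    (h : ∀ᶠ s in 𝓝 t, (φ (γ s)).2 = (φ (γ t)).2) : W.LeafwiseAt γ t := by
  refine ⟨hγ, fun ψ hψ htψ => ?_⟩
  obtain ⟨U, hU, hUW⟩ := W.compatible φ hφ ψ hψ (γ t) ⟨ht, htψ⟩
  filter_upwards [h, hγ hU] with s hs hsU
  exact (hUW _ hsU _ (mem_of_mem_nhds hU)).1 hs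

theorem LeafwiseAt.comp {W : Foliation I n d c X} {Z Z' : Type*} [TopologicalSpace Z]
    [TopologicalSpace Z'] {γ : Z → X} {f : Z' → Z} {t : Z'} (hγ : W.LeafwiseAt γ (f t))
    (hf : ContinuousAt f t) : W.LeafwiseAt (γ ∘ f) t :=
  ⟨hγ.1.comp hf, fun φ hφ ht => hf.eventually (hγ.2 φ hφ ht)⟩

theorem LeafwiseAt.congr {W : Foliation I n d c X} {Z : Type*} [TopologicalSpace Z]
    {γ γ' : Z → X} {t : Z} (hγ : W.LeafwiseAt γ t) (h : γ' =ᶠ[𝓝 t] γ) : W.LeafwiseAt γ' t := by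
  refine ⟨hγ.1.congr h.symm, fun φ hφ ht => ?_⟩
  rw [h.self_of_nhds] at ht ⊢
  filter_upwards [h, hγ.2 φ hφ ht] with s hs hs'
  rw [hs, hs']

theorem mdifferentiableAt_chart (W : Foliation I n d c X) (hn : 1 ≤ n) {φ} (hφ : φ ∈ W.atlas)
    {z : X} (hz : z ∈ φ.source) :
    MDifferentiableAt I 𝓘(ℝ, EuclideanSpace ℝ (Fin d) × EuclideanSpace ℝ (Fin c)) φ z :=
  ((W.contMDiffOn φ hφ).contMDiffAt (φ.open_source.mem_nhds hz)).mdifferentiableAt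
    (by simpa using (zero_lt_one.trans_le hn).ne')

theorem mdifferentiableAt_chart_symm (W : Foliation I n d c X) (hn : 1 ≤ n) {φ} (hφ : φ ∈ W.atlas)
    {w} (hw : w ∈ φ.target) :
    MDifferentiableAt 𝓘(ℝ, EuclideanSpace ℝ (Fin d) × EuclideanSpace ℝ (Fin c)) I φ.symm w :=
  ((W.contMDiffOn_symm φ hφ).contMDiffAt (φ.open_target.mem_nhds hw)).mdifferentiableAt
    (by simpa using (zero_lt_one.trans_le hn).ne')

/-- The derivatives of a foliated chart and of its inverse compose to the identity. -/
theorem mfderiv_chart_comp_symm (W : Foliation I n d c X) (hn : 1 ≤ n) {φ} (hφ : φ ∈ W.atlas)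
    {z : X} (hz : z ∈ φ.source) (v : EuclideanSpace ℝ (Fin d) × EuclideanSpace ℝ (Fin c)) :
    mfderiv I 𝓘(ℝ, EuclideanSpace ℝ (Fin d) × EuclideanSpace ℝ (Fin c)) φ z
      (mfderiv 𝓘(ℝ, EuclideanSpace ℝ (Fin d) × EuclideanSpace ℝ (Fin c)) I φ.symm (φ z) v) = v := by
  have h1 := (W.mdifferentiableAt_chart_symm hn hφ (φ.map_source hz)).hasMFDerivAt
  have h2 : HasMFDerivAt I 𝓘(ℝ, EuclideanSpace ℝ (Fin d) × EuclideanSpace ℝ (Fin c)) φ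
      (φ.symm (φ z)) (mfderiv I 𝓘(ℝ, EuclideanSpace ℝ (Fin d) × EuclideanSpace ℝ (Fin c)) φ z) := by
    have := (W.mdifferentiableAt_chart hn hφ hz).hasMFDerivAt
    have hcast : ∀ w, w = z → HasMFDerivAt I
        𝓘(ℝ, EuclideanSpace ℝ (Fin d) × EuclideanSpace ℝ (Fin c)) φ
        w (mfderiv I 𝓘(ℝ, EuclideanSpace ℝ (Fin d) × EuclideanSpace ℝ (Fin c)) φ z) := by
      rintro _ rfl; exact this
    exact hcast _ (φ.left_inv hz)
  have h3 := h2.comp (φ z) h1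
  have h4 := h3.congr_of_eventuallyEq (f₁ := id) (by
    filter_upwards [φ.open_target.mem_nhds (φ.map_source hz)] with w hw
    exact (φ.right_inv hw).symm)
  exact DFunLike.congr_fun (hasMFDerivAt_unique h4 (hasMFDerivAt_id (φ z))) v

theorem mfderiv_chart_snd (W : Foliation I n d c X) (hn : 1 ≤ n) {φ} (hφ : φ ∈ W.atlas)
    {z : X} (hz : z ∈ φ.source) :
    HasMFDerivAt I 𝓘(ℝ, EuclideanSpace ℝ (Fin c)) (fun w => (φ w).2) z
      ((ContinuousLinearMap.snd ℝ (EuclideanSpace ℝ (Fin d)) (EuclideanSpace ℝ (Fin c))).comp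
        (mfderiv I 𝓘(ℝ, EuclideanSpace ℝ (Fin d) × EuclideanSpace ℝ (Fin c)) φ z)) := by
  have h := ContinuousLinearMap.hasMFDerivAt
    (ContinuousLinearMap.snd ℝ (EuclideanSpace ℝ (Fin d)) (EuclideanSpace ℝ (Fin c))) (x := φ z)
  exact h.comp z (W.mdifferentiableAt_chart hn hφ hz).hasMFDerivAt

theorem tangent_le_ker (W : Foliation I n d c X) {φ} (hφ : φ ∈ W.atlas) {z : X}
    (hz : z ∈ φ.source) :
    W.tangent z ≤ (mfderiv I 𝓘(ℝ, EuclideanSpace ℝ (Fin c)) (fun w => (φ w).2) z).ker :=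
  iInf_le_of_le φ (iInf_le_of_le hφ (iInf_le_of_le hz le_rfl))

end Charts

variable {m q : ℕ} {n : ℕ∞} {M N : Type*} [TopologicalSpace M]
  [ChartedSpace (EuclideanSpace ℝ (Fin m)) M] [TopologicalSpace N]
  [ChartedSpace (EuclideanSpace ℝ (Fin q)) N]
  {W : Foliation ((𝓡 m).prod (𝓡 q)) n m q (M × N)}

/-- For a horizontal foliation, any foliated chart computes the tangent space of the leaf. -/
theorem IsHorizontal.tangent_eq_ker (hW : W.IsHorizontal) (hn : 1 ≤ n) {φ} (hφ : φ ∈ W.atlas)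
    {z : M × N} (hz : z ∈ φ.source) :
    W.tangent z =
      (mfderiv ((𝓡 m).prod (𝓡 q)) 𝓘(ℝ, EuclideanSpace ℝ (Fin q)) (fun w => (φ w).2) z).ker := by
  let V := EuclideanSpace ℝ (Fin m) × EuclideanSpace ℝ (Fin q)
  let T : Submodule ℝ V := W.tangent z
  let l : V →ₗ[ℝ] EuclideanSpace ℝ (Fin q) :=
    (mfderiv ((𝓡 m).prod (𝓡 q)) 𝓘(ℝ, EuclideanSpace ℝ (Fin q)) (fun w => (φ w).2) z).toLinearMap
  let f : V →ₗ[ℝ] EuclideanSpace ℝ (Fin m) :=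
    (mfderiv ((𝓡 m).prod (𝓡 q)) (𝓡 m) (Prod.fst : M × N → M) z).toLinearMap
  have hle : T ≤ l.ker := W.tangent_le_ker hφ hz
  have hl : Function.Surjective l := by
    intro v
    refine ⟨mfderiv 𝓘(ℝ, EuclideanSpace ℝ (Fin m) × EuclideanSpace ℝ (Fin q)) ((𝓡 m).prod (𝓡 q))
      φ.symm (φ z) (0, v), ?_⟩
    change mfderiv ((𝓡 m).prod (𝓡 q)) 𝓘(ℝ, EuclideanSpace ℝ (Fin q)) (fun w => (φ w).2) z _ = v
    rw [(W.mfderiv_chart_snd hn hφ hz).mfderiv]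
    exact congrArg Prod.snd (W.mfderiv_chart_comp_symm hn hφ hz ((0, v) :
      EuclideanSpace ℝ (Fin m) × EuclideanSpace ℝ (Fin q)))
  have hcompl : IsCompl T f.ker := hW z
  -- Dimension count: `T` complements the `q`-dimensional vertical space and `l` is onto `ℝ^q`, so
  -- `T` and the kernel of `l` both have dimension `m`.
  have h1 := Submodule.finrank_add_eq_of_isCompl hcompl
  have h2 := LinearMap.finrank_range_add_finrank_ker l
  have h3 := LinearMap.finrank_range_add_finrank_ker f
  have h4 : Module.finrank ℝ l.range = q := by
    rw [LinearMap.range_eq_top.2 hl, finrank_top]; simp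
  have hf : Function.Surjective f := by
    intro v
    refine ⟨(v, 0), ?_⟩
    change mfderiv ((𝓡 m).prod (𝓡 q)) (𝓡 m) (Prod.fst : M × N → M) z (v, 0) = v
    rw [mfderiv_fst]; rfl
  have h5 : Module.finrank ℝ f.range = m := by
    rw [LinearMap.range_eq_top.2 hf, finrank_top]; simp
  have h6 : Module.finrank ℝ V = m + q := by simp [V]
  have h7 : T = l.ker := Submodule.eq_of_le_of_finrank_le hle (by omega)
  exact h7

/-- A `C^1` map that preserves the tangent distribution of a horizontal foliation preserves the
leaves. -/
theorem IsHorizontal.leafwiseAt_comp (hW : W.IsHorizontal) (hn : 1 ≤ n) {F : M × N → M × N}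
    (hF : ContMDiff ((𝓡 m).prod (𝓡 q)) ((𝓡 m).prod (𝓡 q)) 1 F) (hinv : W.IsInvariant F)
    {Z : Type*} [TopologicalSpace Z] {γ : Z → M × N} {t : Z} (hγ : W.LeafwiseAt γ t) :
    W.LeafwiseAt (F ∘ γ) t := by
  obtain ⟨φ, hφ, hz⟩ := W.covers (γ t)
  obtain ⟨ψ, hψ, hz'⟩ := W.covers (F (γ t))
  let V := EuclideanSpace ℝ (Fin m) × EuclideanSpace ℝ (Fin q)
  refine LeafwiseAt.of_chart (hF.continuous.continuousAt.comp hγ.1) hψ hz' ?_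
  -- the transverse coordinate of `F` in the chart `φ` is locally constant along plaques
  let G : V → EuclideanSpace ℝ (Fin q) := fun w => (ψ (F (φ.symm w))).2
  have hD : φ.target ∩ φ.symm ⁻¹' (F ⁻¹' ψ.source) ∈ 𝓝 (φ (γ t)) := by
    refine Filter.inter_mem (φ.open_target.mem_nhds (φ.map_source hz)) ?_
    have hc : ContinuousAt (F ∘ φ.symm) (φ (γ t)) :=
      hF.continuous.continuousAt.comp (φ.continuousAt_symm (φ.map_source hz))
    refine hc.preimage_mem_nhds (ψ.open_source.mem_nhds ?_)
    rw [Function.comp_apply, φ.left_inv hz]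
    exact hz'
  rw [show φ (γ t) = ((φ (γ t)).1, (φ (γ t)).2) from rfl, nhds_prod_eq] at hD
  obtain ⟨A, hA, B, hB, hAB⟩ := Filter.mem_prod_iff.1 hD
  obtain ⟨r, hr, hball⟩ := Metric.mem_nhds_iff.1 hA
  -- A plaque direction `(v, 0)` is tangent to `W`, the derivative of `F` keeps it tangent, and the
  -- transverse coordinate of `ψ` kills tangent vectors.
  have hGd : ∀ a ∈ Metric.ball (φ (γ t)).1 r, ∀ b ∈ B,
      HasFDerivAt (fun a => G (a, b)) (0 : EuclideanSpace ℝ (Fin m) →L[ℝ] EuclideanSpace ℝ (Fin q))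
        a := by
    intro a ha b hb
    obtain ⟨hab, hab'⟩ := hAB (Set.mk_mem_prod (hball ha) hb)
    have hw : φ.symm (a, b) ∈ φ.source := φ.map_target hab
    have hw' : F (φ.symm (a, b)) ∈ ψ.source := hab'
    have h1 := (W.mdifferentiableAt_chart_symm hn hφ hab).hasMFDerivAt
    have h2 := (hF.mdifferentiableAt one_ne_zero (x := φ.symm (a, b))).hasMFDerivAt
    have h3 := ((W.mfderiv_chart_snd hn hψ hw').mdifferentiableAt).hasMFDerivAt
    have h4 := HasMFDerivAt.comp (f := F ∘ φ.symm) (a, b) h3 (h2.comp (a, b) h1)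
    have h5 : HasFDerivAt G _ (a, b) := hasMFDerivAt_iff_hasFDerivAt.1 h4
    have h6 : HasFDerivAt (fun a : EuclideanSpace ℝ (Fin m) => (a, b))
      (ContinuousLinearMap.inl ℝ _ (EuclideanSpace ℝ (Fin q))) a := hasFDerivAt_prodMk_left a b
    have h7 := h5.comp a h6
    refine h7.congr_fderiv ?_
    ext1 v
    have hv : mfderiv 𝓘(ℝ, V) ((𝓡 m).prod (𝓡 q)) φ.symm (a, b) (v, 0) ∈
        W.tangent (φ.symm (a, b)) := by
      rw [hW.tangent_eq_ker hn hφ hw, LinearMap.mem_ker]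
      change mfderiv _ _ (fun w => (φ w).2) (φ.symm (a, b)) _ = 0
      rw [(W.mfderiv_chart_snd hn hφ hw).mfderiv]
      have h8 := W.mfderiv_chart_comp_symm hn hφ hw ((v, 0) : V)
      have hcast : ∀ w, w = (a, b) → (mfderiv ((𝓡 m).prod (𝓡 q)) 𝓘(ℝ, V) φ (φ.symm (a, b))
          (mfderiv 𝓘(ℝ, V) ((𝓡 m).prod (𝓡 q)) φ.symm w ((v, 0) : V)) : V) = (v, 0) →
          (mfderiv ((𝓡 m).prod (𝓡 q)) 𝓘(ℝ, V) φ (φ.symm (a, b))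
          (mfderiv 𝓘(ℝ, V) ((𝓡 m).prod (𝓡 q)) φ.symm (a, b) ((v, 0) : V)) : V) = (v, 0) := by
        rintro _ rfl h; exact h
      exact congrArg Prod.snd (hcast _ (φ.right_inv hab) h8)
    have hFv : mfderiv ((𝓡 m).prod (𝓡 q)) ((𝓡 m).prod (𝓡 q)) F (φ.symm (a, b))
        (mfderiv 𝓘(ℝ, V) ((𝓡 m).prod (𝓡 q)) φ.symm (a, b) (v, 0)) ∈
        W.tangent (F (φ.symm (a, b))) := by
      rw [← hinv]
      exact Submodule.mem_map_of_mem hv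
    exact W.tangent_le_ker hψ hw' hFv
  have hconst : ∀ a ∈ Metric.ball (φ (γ t)).1 r, ∀ b ∈ B, G (a, b) = G ((φ (γ t)).1, b) := by
    intro a ha b hb
    exact Metric.isOpen_ball.is_const_of_fderiv_eq_zero (𝕜 := ℝ)
      (f := fun a => G (a, b)) (convex_ball _ r).isPreconnected
      (fun a ha => (hGd a ha b hb).differentiableAt.differentiableWithinAt)
      (fun a ha => (hGd a ha b hb).fderiv) ha (Metric.mem_ball_self hr)
  have hb0 : (φ (γ t)).2 ∈ B := mem_of_mem_nhds hB
  have hcont : ContinuousAt (fun s => (φ (γ s)).1) t :=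
    continuous_fst.continuousAt.comp ((φ.continuousAt hz).comp hγ.1)
  filter_upwards [hγ.2 φ hφ hz, hγ.1 (φ.open_source.mem_nhds hz),
    hcont.preimage_mem_nhds (Metric.ball_mem_nhds _ hr)] with s hs hsz hsr
  have h1 := hconst (φ (γ s)).1 hsr (φ (γ t)).2 hb0
  have h2 : G (φ (γ s)) = (ψ (F (γ s))).2 := by simp only [G]; rw [φ.left_inv hsz]
  have h3 : G (φ (γ t)) = (ψ (F (γ t))).2 := by simp only [G]; rw [φ.left_inv hz]
  have h4 : φ (γ s) = ((φ (γ s)).1, (φ (γ t)).2) := Prod.ext rfl hs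
  rw [Function.comp_apply, Function.comp_apply, ← h2, ← h3, h4, h1]

end Foliation

/-! ### Local coordinates, uniqueness of leafwise maps, and local transport -/

namespace Foliation

variable {m q : ℕ} {n : ℕ∞} {M N : Type*} [TopologicalSpace M]
  [ChartedSpace (EuclideanSpace ℝ (Fin m)) M] [IsManifold (𝓡 m) ∞ M] [TopologicalSpace N]
  [ChartedSpace (EuclideanSpace ℝ (Fin q)) N] [IsManifold (𝓡 q) ∞ N]
  {W : Foliation ((𝓡 m).prod (𝓡 q)) n m q (M × N)}

/-- The model vector space of a product of manifolds of dimensions `m` and `q`. -/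
abbrev ProductModel (m q : ℕ) : Type := EuclideanSpace ℝ (Fin m) × EuclideanSpace ℝ (Fin q)

/-- Near a point, the projection to `M` and the transverse coordinate of a foliated chart form a
`C^n` coordinate system. -/
theorem IsHorizontal.exists_coordinates (hW : W.IsHorizontal) (hn : 1 ≤ n) {φ} (hφ : φ ∈ W.atlas)
    {x₀ : M} {y₀ : N} (hz : (x₀, y₀) ∈ φ.source) :
    ∃ R : OpenPartialHomeomorph (EuclideanSpace ℝ (Fin m) × EuclideanSpace ℝ (Fin q))
        (EuclideanSpace ℝ (Fin m) × EuclideanSpace ℝ (Fin q)),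
      (extChartAt (𝓡 m) x₀ x₀, extChartAt (𝓡 q) y₀ y₀) ∈ R.source ∧
      (∀ w ∈ R.source, w.1 ∈ (extChartAt (𝓡 m) x₀).target ∧ w.2 ∈ (extChartAt (𝓡 q) y₀).target ∧
        ((extChartAt (𝓡 m) x₀).symm w.1, (extChartAt (𝓡 q) y₀).symm w.2) ∈ φ.source) ∧
      (∀ w, R w =
        (w.1, (φ ((extChartAt (𝓡 m) x₀).symm w.1, (extChartAt (𝓡 q) y₀).symm w.2)).2)) ∧
      (∀ w ∈ R.source, ContDiffAt ℝ n R w) ∧ ∀ w ∈ R.target, ContDiffAt ℝ n R.symm w := by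
  set eM := extChartAt (𝓡 m) x₀ with heM
  set eN := extChartAt (𝓡 q) y₀ with heN
  have hn0 : (n : WithTop ℕ∞) ≠ 0 := by simpa using (zero_lt_one.trans_le hn).ne'
  have hnle : (n : WithTop ℕ∞) ≤ ∞ := by exact_mod_cast le_top
  let κ : ProductModel m q → M × N := fun w => (eM.symm w.1, eN.symm w.2)
  let D₀ : Set (ProductModel m q) := eM.target ×ˢ eN.target
  have hD₀ : IsOpen D₀ := (isOpen_extChartAt_target x₀).prod (isOpen_extChartAt_target y₀)
  have hκ : ContMDiffOn 𝓘(ℝ, ProductModel m q) ((𝓡 m).prod (𝓡 q)) ∞ κ D₀ := by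
    refine ContMDiffOn.prodMk ?_ ?_
    · exact (contMDiffOn_extChartAt_symm x₀).comp contDiff_fst.contMDiff.contMDiffOn
        fun w hw => hw.1
    · exact (contMDiffOn_extChartAt_symm y₀).comp contDiff_snd.contMDiff.contMDiffOn
        fun w hw => hw.2
  let D : Set (ProductModel m q) := D₀ ∩ κ ⁻¹' φ.source
  have hD : IsOpen D := hκ.continuousOn.isOpen_inter_preimage hD₀ φ.open_source
  let Ψ : ProductModel m q → ProductModel m q := fun w => (w.1, (φ (κ w)).2)
  have hΨ : ∀ w ∈ D, ContDiffAt ℝ n Ψ w := by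
    intro w hw
    have h1 : ContMDiffAt 𝓘(ℝ, ProductModel m q) ((𝓡 m).prod (𝓡 q)) n κ w :=
      (hκ.contMDiffAt (hD₀.mem_nhds hw.1)).of_le hnle
    have h2 : ContMDiffAt 𝓘(ℝ, ProductModel m q) 𝓘(ℝ, ProductModel m q) n (fun w => φ (κ w)) w :=
      ((W.contMDiffOn φ hφ).contMDiffAt (φ.open_source.mem_nhds hw.2)).comp w h1
    exact contDiffAt_fst.prodMk (contDiffAt_snd.comp w (contMDiffAt_iff_contDiffAt.1 h2))
  -- A vector killed by the derivative of `Ψ` is vertical and tangent to `W`, hence zero by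
  -- transversality.
  have hinj : ∀ w ∈ D, Function.Injective (fderiv ℝ Ψ w) := by
    intro w hw
    have hκd : MDifferentiableAt 𝓘(ℝ, ProductModel m q) ((𝓡 m).prod (𝓡 q)) κ w :=
      (hκ.contMDiffAt (hD₀.mem_nhds hw.1)).mdifferentiableAt (by simp)
    rw [injective_iff_map_eq_zero]
    intro v hv
    have hΨw := ((hΨ w hw).differentiableAt hn0).hasFDerivAt
    have hv1 : v.1 = 0 := by
      have h := (hasFDerivAt_fst (𝕜 := ℝ) (p := Ψ w)).comp w hΨw
      have h' := (hasFDerivAt_fst (𝕜 := ℝ) (p := w)).unique h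
      have := DFunLike.congr_fun h' v
      exact this.trans (by simp [hv])
    have hv2 : mfderiv ((𝓡 m).prod (𝓡 q)) 𝓘(ℝ, EuclideanSpace ℝ (Fin q)) (fun z => (φ z).2) (κ w)
        (mfderiv 𝓘(ℝ, ProductModel m q) ((𝓡 m).prod (𝓡 q)) κ w v) = 0 := by
      have h := (hasFDerivAt_snd (𝕜 := ℝ) (p := Ψ w)).comp w hΨw
      have h2 : HasMFDerivAt 𝓘(ℝ, ProductModel m q) 𝓘(ℝ, EuclideanSpace ℝ (Fin q))
          ((fun z => (φ z).2) ∘ κ) w _ :=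
        (W.mfderiv_chart_snd hn hφ hw.2).mdifferentiableAt.hasMFDerivAt.comp w hκd.hasMFDerivAt
      have h' := hasMFDerivAt_unique h2 h.hasMFDerivAt
      have := DFunLike.congr_fun h' v
      exact this.trans (congrArg Prod.snd hv)
    have hv3 : mfderiv ((𝓡 m).prod (𝓡 q)) (𝓡 m) (Prod.fst : M × N → M) (κ w)
        (mfderiv 𝓘(ℝ, ProductModel m q) ((𝓡 m).prod (𝓡 q)) κ w v) = 0 := by
      have h1 : HasMFDerivAt 𝓘(ℝ, ProductModel m q) (𝓡 m) (Prod.fst ∘ κ) w _ :=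
        (mdifferentiableAt_fst (I := 𝓡 m) (I' := 𝓡 q) (x := κ w)).hasMFDerivAt.comp w
          hκd.hasMFDerivAt
      have h2 : MDifferentiableAt 𝓘(ℝ, EuclideanSpace ℝ (Fin m)) (𝓡 m) eM.symm w.1 :=
        ((contMDiffOn_extChartAt_symm (n := ∞) x₀).contMDiffAt
          ((isOpen_extChartAt_target x₀).mem_nhds hw.1.1)).mdifferentiableAt (by simp)
      have h3 : HasMFDerivAt 𝓘(ℝ, ProductModel m q) 𝓘(ℝ, EuclideanSpace ℝ (Fin m))
          (Prod.fst : ProductModel m q → _) w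
          (ContinuousLinearMap.fst ℝ (EuclideanSpace ℝ (Fin m)) (EuclideanSpace ℝ (Fin q))) :=
        hasFDerivAt_fst.hasMFDerivAt
      have h4 : HasMFDerivAt 𝓘(ℝ, ProductModel m q) (𝓡 m) (Prod.fst ∘ κ) w _ :=
        h2.hasMFDerivAt.comp w h3
      have h5 := DFunLike.congr_fun (hasMFDerivAt_unique h1 h4) v
      refine h5.trans ?_
      change mfderiv 𝓘(ℝ, EuclideanSpace ℝ (Fin m)) (𝓡 m) eM.symm w.1 v.1 = 0
      rw [hv1]; exact map_zero _
    have hzero : mfderiv 𝓘(ℝ, ProductModel m q) ((𝓡 m).prod (𝓡 q)) κ w v = 0 := by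
      have h1 : mfderiv 𝓘(ℝ, ProductModel m q) ((𝓡 m).prod (𝓡 q)) κ w v ∈ W.tangent (κ w) := by
        rw [hW.tangent_eq_ker hn hφ hw.2]; exact hv2
      exact (Submodule.disjoint_def.1 (hW (κ w)).disjoint) _ h1 hv3
    have h1 : MDifferentiableAt ((𝓡 m).prod (𝓡 q)) 𝓘(ℝ, EuclideanSpace ℝ (Fin q))
        (fun z : M × N => eN z.2) (κ w) := by
      have h : MDifferentiableAt (𝓡 q) 𝓘(ℝ, EuclideanSpace ℝ (Fin q)) eN (κ w).2 :=
        (contMDiffAt_extChartAt' (n := ∞) (by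
          have := eN.map_target hw.1.2
          rwa [extChartAt_source] at this)).mdifferentiableAt (by simp)
      exact h.comp (κ w) mdifferentiableAt_snd
    have h2 : HasMFDerivAt 𝓘(ℝ, ProductModel m q) 𝓘(ℝ, EuclideanSpace ℝ (Fin q))
        ((fun z : M × N => eN z.2) ∘ κ) w _ := h1.hasMFDerivAt.comp w hκd.hasMFDerivAt
    have h3 : HasMFDerivAt 𝓘(ℝ, ProductModel m q) 𝓘(ℝ, EuclideanSpace ℝ (Fin q))
        (Prod.snd : ProductModel m q → _) w
        (ContinuousLinearMap.snd ℝ (EuclideanSpace ℝ (Fin m)) (EuclideanSpace ℝ (Fin q))) :=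
      hasFDerivAt_snd.hasMFDerivAt
    have h4 := h2.congr_of_eventuallyEq (f₁ := (Prod.snd : ProductModel m q → _)) (by
      filter_upwards [hD₀.mem_nhds hw.1] with u hu
      exact (eN.right_inv hu.2).symm)
    have h5 := DFunLike.congr_fun (hasMFDerivAt_unique h3 h4) v
    have hv4 : v.2 = 0 := by
      refine (h5 : v.2 = _).trans ?_
      change mfderiv _ _ (fun z : M × N => eN z.2) (κ w) (mfderiv _ _ κ w v) = 0
      rw [hzero]; exact map_zero _
    exact Prod.ext hv1 hv4
  have hequiv : ∀ w ∈ D, ∃ e : ProductModel m q ≃L[ℝ] ProductModel m q,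
      HasFDerivAt Ψ (e : ProductModel m q →L[ℝ] ProductModel m q) w := by
    intro w hw
    let e := (LinearEquiv.ofInjectiveEndo (fderiv ℝ Ψ w).toLinearMap
      (hinj w hw)).toContinuousLinearEquiv
    refine ⟨e, ?_⟩
    have : (e : ProductModel m q →L[ℝ] ProductModel m q) = fderiv ℝ Ψ w :=
      ContinuousLinearMap.ext fun v => rfl
    rw [this]
    exact ((hΨ w hw).differentiableAt hn0).hasFDerivAt
  have hκ0 : κ (eM x₀, eN y₀) = (x₀, y₀) := by
    simp only [κ, heM, heN, extChartAt_to_inv]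
  have hw₀ : (eM x₀, eN y₀) ∈ D := by
    refine ⟨⟨mem_extChartAt_target x₀, mem_extChartAt_target y₀⟩, ?_⟩
    rw [Set.mem_preimage, hκ0]; exact hz
  obtain ⟨e₀, he₀⟩ := hequiv _ hw₀
  -- Restricting to `D`, where the derivative is invertible at every point, makes the inverse `C^n`
  -- on the whole target.
  let R := ((hΨ _ hw₀).toOpenPartialHomeomorph Ψ he₀ hn0).restrOpen D hD
  have hR : ∀ w, R w = Ψ w := fun w => rfl
  have hRs : R.source ⊆ D := fun w hw => hw.2
  refine ⟨R, ⟨(hΨ _ hw₀).mem_toOpenPartialHomeomorph_source he₀ hn0, hw₀⟩, ?_, hR, ?_, ?_⟩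
  · intro w hw
    exact ⟨(hRs hw).1.1, (hRs hw).1.2, (hRs hw).2⟩
  · intro w hw
    exact hΨ w (hRs hw)
  · intro w hw
    obtain ⟨e, he⟩ := hequiv _ (hRs (R.map_target hw))
    exact R.contDiffAt_symm hw he (hΨ _ (hRs (R.map_target hw)))

/-- Near a point, a point is determined by its projection to `M` and its plaque. -/
theorem IsHorizontal.exists_nhds_injOn (hW : W.IsHorizontal) (hn : 1 ≤ n) {φ} (hφ : φ ∈ W.atlas)
    {z : M × N} (hz : z ∈ φ.source) :
    ∃ O ∈ 𝓝 z, ∀ w ∈ O, ∀ w' ∈ O, w.1 = w'.1 → (φ w).2 = (φ w').2 → w = w' := by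
  obtain ⟨x₀, y₀⟩ := z
  obtain ⟨R, hR0, hRD, hR, -, -⟩ := hW.exists_coordinates hn hφ hz
  let e : M × N → EuclideanSpace ℝ (Fin m) × EuclideanSpace ℝ (Fin q) :=
    fun w => (extChartAt (𝓡 m) x₀ w.1, extChartAt (𝓡 q) y₀ w.2)
  have he : ContinuousAt e (x₀, y₀) :=
    (ContinuousAt.comp (g := extChartAt (𝓡 m) x₀) (f := Prod.fst) (x := (x₀, y₀))
      (continuousAt_extChartAt x₀) continuousAt_fst).prodMk
      (ContinuousAt.comp (g := extChartAt (𝓡 q) y₀) (f := Prod.snd) (x := (x₀, y₀))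
      (continuousAt_extChartAt y₀) continuousAt_snd)
  refine ⟨e ⁻¹' R.source ∩
    ((extChartAt (𝓡 m) x₀).source ×ˢ (extChartAt (𝓡 q) y₀).source),
    Filter.inter_mem (he.preimage_mem_nhds (R.open_source.mem_nhds hR0))
      (prod_mem_nhds (extChartAt_source_mem_nhds x₀) (extChartAt_source_mem_nhds y₀)), ?_⟩
  rintro w ⟨hw, hw1, hw2⟩ w' ⟨hw', hw1', hw2'⟩ h1 h2
  have h3 : R (e w) = R (e w') := by
    rw [hR, hR]
    simp only [e]
    rw [(extChartAt (𝓡 m) x₀).left_inv hw1, (extChartAt (𝓡 q) y₀).left_inv hw2,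
      (extChartAt (𝓡 m) x₀).left_inv hw1', (extChartAt (𝓡 q) y₀).left_inv hw2']
    exact Prod.ext (congrArg (extChartAt (𝓡 m) x₀) h1) h2
  have h4 := R.injOn hw hw' h3
  refine Prod.ext h1 ?_
  have h5 := congrArg Prod.snd h4
  exact (extChartAt (𝓡 q) y₀).injOn hw2 hw2' h5

/-- Leafwise maps over the same map to `M` agree near a point if they agree at this point. -/
theorem IsHorizontal.eventually_eq (hW : W.IsHorizontal) (hn : 1 ≤ n) {Z : Type*}
    [TopologicalSpace Z] {γ γ' : Z → M × N} {t : Z} (hγ : W.LeafwiseAt γ t)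
    (hγ' : W.LeafwiseAt γ' t) (hfst : ∀ s, (γ s).1 = (γ' s).1) (ht : γ t = γ' t) :
    ∀ᶠ s in 𝓝 t, γ s = γ' s := by
  obtain ⟨φ, hφ, hz⟩ := W.covers (γ t)
  obtain ⟨O, hO, hinj⟩ := hW.exists_nhds_injOn hn hφ hz
  filter_upwards [hγ.1 hO, hγ'.1 (ht ▸ hO), hγ.2 φ hφ hz, hγ'.2 φ hφ (ht ▸ hz)]
    with s h1 h2 h3 h4
  exact hinj _ h1 _ h2 (hfst s) (by rw [h3, h4, ht])

/-- Leafwise maps over the same map to `M` agree on a connected set if they agree at a point. -/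
theorem IsHorizontal.eqOn (hW : W.IsHorizontal) (hn : 1 ≤ n) [T2Space N] {Z : Type*}
    [TopologicalSpace Z] {γ γ' : Z → M × N} {S : Set Z} (hS : IsPreconnected S)
    (hγ : ∀ t ∈ S, W.LeafwiseAt γ t) (hγ' : ∀ t ∈ S, W.LeafwiseAt γ' t)
    (hfst : ∀ s, (γ s).1 = (γ' s).1) {t : Z} (ht : t ∈ S) (h : γ t = γ' t) : Set.EqOn γ γ' S := by
  -- Agreement is open by local uniqueness and disagreement is open because `N` is Hausdorff.
  have hcov : S ⊆ {t | ∀ᶠ s in 𝓝 t, γ s = γ' s} ∪ {t | ∀ᶠ s in 𝓝 t, γ s ≠ γ' s} := by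
    intro s hs
    by_cases hs' : γ s = γ' s
    · exact Or.inl (hW.eventually_eq hn (hγ s hs) (hγ' s hs) hfst hs')
    · refine Or.inr ?_
      have hne : (γ s).2 ≠ (γ' s).2 := fun h => hs' (Prod.ext (hfst s) h)
      have h1 : ContinuousAt (fun s => (γ s).2) s := continuousAt_snd.comp (hγ s hs).1
      have h2 : ContinuousAt (fun s => (γ' s).2) s := continuousAt_snd.comp (hγ' s hs).1
      filter_upwards [(h1.ne_iff_eventually_ne h2).1 hne] with r hr hr'
      exact hr (congrArg Prod.snd hr')
  intro s hs
  by_contra hne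
  obtain ⟨r, -, hr1, hr2⟩ := hS _ _ isOpen_setOfPred_eventually_nhds
    isOpen_setOfPred_eventually_nhds hcov
    ⟨t, ht, hW.eventually_eq hn (hγ t ht) (hγ' t ht) hfst h⟩
    ⟨s, hs, (hcov hs).resolve_left fun h => hne h.self_of_nhds⟩
  exact hr2.self_of_nhds hr1.self_of_nhds

/-- Local parallel transport along the leaves of a horizontal foliation. -/
theorem IsHorizontal.exists_local_transport (hW : W.IsHorizontal) (hn : 1 ≤ n) (x₀ : M) (y₀ : N) :
    ∃ (U : Set M) (V : Set N) (S : M → M → N → N), IsOpen U ∧ x₀ ∈ U ∧ IsOpen V ∧ y₀ ∈ V ∧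
      (∀ x ∈ U, ∀ y ∈ V, S x x y = y) ∧
      (∀ x₁ ∈ U, ∀ x ∈ U, ∀ y ∈ V, W.LeafwiseAt (fun x => (x, S x₁ x y)) x) ∧
      ∀ x₁ ∈ U, ∀ x₂ ∈ U, ContMDiffOn (𝓡 q) (𝓡 q) n (S x₁ x₂) V := by
  obtain ⟨φ, hφ, hz⟩ := W.covers (x₀, y₀)
  obtain ⟨R, hR0, hRD, hR, hRs, hRt⟩ := hW.exists_coordinates hn hφ hz
  have hnle : (n : WithTop ℕ∞) ≤ ∞ := by exact_mod_cast le_top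
  set eM := extChartAt (𝓡 m) x₀ with heM
  set eN := extChartAt (𝓡 q) y₀ with heN
  set w₀ := (eM x₀, eN y₀) with hw₀
  have ht0 : R.target ∈ 𝓝 ((R w₀).1, (R w₀).2) := R.open_target.mem_nhds (R.map_source hR0)
  rw [nhds_prod_eq] at ht0
  obtain ⟨A, hA, B, hB, hAB⟩ := Filter.mem_prod_iff.1 ht0
  have hs0 : R.source ∩ R ⁻¹' (Set.univ ×ˢ B) ∈ 𝓝 (w₀.1, w₀.2) :=
    Filter.inter_mem (R.open_source.mem_nhds hR0)
      ((R.continuousAt hR0).preimage_mem_nhds (prod_mem_nhds Filter.univ_mem hB))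
  rw [nhds_prod_eq] at hs0
  obtain ⟨A', hA', B', hB', hAB'⟩ := Filter.mem_prod_iff.1 hs0
  have hR1 : ∀ w, (R w).1 = w.1 := fun w => by rw [hR]
  have hsymm1 : ∀ w ∈ R.target, (R.symm w).1 = w.1 := fun w hw => by
    rw [← hR1, R.right_inv hw]
  -- Follow the plaque: keep the transverse coordinate of `(x₁, y)` and change the projection to
  -- `x`.
  let S : M → M → N → N := fun x₁ x y => eN.symm (R.symm (eM x, (R (eM x₁, eN y)).2)).2
  obtain ⟨U', hU'sub, hU'o, hU'0⟩ := mem_nhds_iff.1 (Filter.inter_mem hA' (hR1 w₀ ▸ hA))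
  obtain ⟨V', hV'sub, hV'o, hV'0⟩ := mem_nhds_iff.1 hB'
  let U : Set M := eM.source ∩ eM ⁻¹' U'
  let V : Set N := eN.source ∩ eN ⁻¹' V'
  have hUo : IsOpen U := (continuousOn_extChartAt x₀).isOpen_inter_preimage
    (isOpen_extChartAt_source x₀) hU'o
  have hVo : IsOpen V := (continuousOn_extChartAt y₀).isOpen_inter_preimage
    (isOpen_extChartAt_source y₀) hV'o
  have hsrc : ∀ x ∈ U, ∀ y ∈ V, (eM x, eN y) ∈ R.source ∧ (R (eM x, eN y)).2 ∈ B := by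
    intro x hx y hy
    have := hAB' (Set.mk_mem_prod (hU'sub hx.2).1 (hV'sub hy.2))
    exact ⟨this.1, this.2.2⟩
  have htgt : ∀ x ∈ U, ∀ b ∈ B, (eM x, b) ∈ R.target := fun x hx b hb =>
    hAB (Set.mk_mem_prod (hU'sub hx.2).2 hb)
  refine ⟨U, V, S, hUo, ⟨mem_extChartAt_source x₀, hU'0⟩, hVo, ⟨mem_extChartAt_source y₀, hV'0⟩,
    ?_, ?_, ?_⟩
  · intro x hx y hy
    simp only [S]
    have h1 : (eM x, (R (eM x, eN y)).2) = R (eM x, eN y) := Prod.ext (hR1 (eM x, eN y)).symm rfl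
    rw [h1, R.left_inv (hsrc x hx y hy).1, eN.left_inv hy.1]
  · intro x₁ hx₁ x hx y hy
    set b := (R (eM x₁, eN y)).2 with hb
    have hbB : b ∈ B := (hsrc x₁ hx₁ y hy).2
    have hpt : ∀ x ∈ U, (x, S x₁ x y) ∈ φ.source ∧ (φ (x, S x₁ x y)).2 = b := by
      intro x hx
      have h1 := htgt x hx b hbB
      have h2 := hRD _ (R.map_target h1)
      rw [hsymm1 _ h1] at h2
      simp only [eM.left_inv hx.1] at h2
      refine ⟨h2.2.2, ?_⟩
      have h3 := congrArg Prod.snd (hR (R.symm (eM x, b)))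
      rw [R.right_inv h1, hsymm1 _ h1] at h3
      simp only [eM.left_inv hx.1] at h3
      exact h3.symm
    refine LeafwiseAt.of_chart ?_ hφ (hpt x hx).1 ?_
    · have h1 := htgt x hx b hbB
      refine continuousAt_id.prodMk ?_
      have h2 : ContinuousAt (fun x => (R.symm (eM x, b)).2) x := by
        have h3 : ContinuousAt (fun x => (eM x, b)) x :=
          (continuousAt_extChartAt' hx.1).prodMk continuousAt_const
        exact continuousAt_snd.comp (ContinuousAt.comp (g := R.symm) (R.continuousAt_symm h1) h3)
      have h3 : ContinuousAt eN.symm (R.symm (eM x, b)).2 :=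
        continuousAt_extChartAt_symm'' (hRD _ (R.map_target h1)).2.1
      exact ContinuousAt.comp (g := eN.symm) h3 h2
    · filter_upwards [hUo.mem_nhds hx] with x' hx'
      rw [(hpt x' hx').2, (hpt x hx).2]
  · intro x₁ hx₁ x₂ hx₂ y hy
    refine ContMDiffAt.contMDiffWithinAt ?_
    have h1 := htgt x₂ hx₂ _ (hsrc x₁ hx₁ y hy).2
    have hyN : ContMDiffAt (𝓡 q) 𝓘(ℝ, EuclideanSpace ℝ (Fin q)) n eN y :=
      contMDiffAt_extChartAt' (by simpa [heN] using hy.1) |>.of_le hnle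
    have hcoord : ContDiffAt ℝ n (fun η => (R.symm (eM x₂, (R (eM x₁, η)).2)).2) (eN y) := by
      have h2 : ContDiffAt ℝ n (fun η => R (eM x₁, η)) (eN y) :=
        (hRs _ (hsrc x₁ hx₁ y hy).1).comp (eN y) (contDiffAt_const.prodMk contDiffAt_id)
      have h3 : ContDiffAt ℝ n (fun η => (eM x₂, (R (eM x₁, η)).2)) (eN y) :=
        contDiffAt_const.prodMk (contDiffAt_snd.comp (eN y) h2)
      exact contDiffAt_snd.comp (eN y) ((hRt _ h1).comp (eN y) h3)
    have hsymm : ContMDiffAt 𝓘(ℝ, EuclideanSpace ℝ (Fin q)) (𝓡 q) n eN.symm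
        (R.symm (eM x₂, (R (eM x₁, eN y)).2)).2 :=
      ((contMDiffOn_extChartAt_symm y₀).contMDiffAt ((isOpen_extChartAt_target y₀).mem_nhds
        (hRD _ (R.map_target h1)).2.1)).of_le hnle
    exact hsymm.comp y (hcoord.contMDiffAt.comp y hyN)

end Foliation

/-! ### From local to global transport over a simply connected space -/

/-- Flat local transports over a space lift to sections over any simply connected space mapping to
it. -/
theorem exists_flat_section {B F A : Type*} [TopologicalSpace B] [TopologicalSpace A]
    [SimplyConnectedSpace A] [LocallyPathConnectedSpace A] (U : B → Set B) (T : B → B → B → F → F)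
    (hUo : ∀ i, IsOpen (U i)) (hU : ∀ i, i ∈ U i) (hT : ∀ i, ∀ x ∈ U i, ∀ v, T i x x v = v)
    (hcomp : ∀ i, ∀ x₁ ∈ U i, ∀ x₂ ∈ U i, ∀ x₃ ∈ U i, ∀ v,
      T i x₂ x₃ (T i x₁ x₂ v) = T i x₁ x₃ v)
    (hcompat : ∀ i j, ∀ x₁ ∈ U i ∩ U j, ∀ v, ∀ᶠ x in 𝓝 x₁, T i x₁ x v = T j x₁ x v)
    (f : C(A, B)) (a₀ : A) (v₀ : F) :
    ∃ ℓ : A → F, ℓ a₀ = v₀ ∧ ∀ a, ∀ᶠ a' in 𝓝 a, ℓ a' = T (f a) (f a) (f a') (ℓ a) := by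
  -- With a discrete fiber the bundle is a covering, and lifting `f` to its total space is possible
  -- because `A` is simply connected.
  let _ : TopologicalSpace F := ⊥
  have : DiscreteTopology F := ⟨rfl⟩
  let Z : FiberBundleCore B B F :=
    { baseSet := U
      isOpen_baseSet := hUo
      indexAt := id
      mem_baseSet_at := hU
      -- The chart at `i` records a point over `x` by its transport to the fiber over `i`: go from
      -- `i` to `x` with `T i`, then from `x` to `j` with `T j`.
      coordChange := fun i j x v => T j x j (T i i x v)
      coordChange_self := fun i x hx v => by
        rw [hcomp i i (hU i) x hx i (hU i), hT i i (hU i)]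
      continuousOn_coordChange := by
        rintro i j ⟨x₁, v⟩ ⟨hx₁, -⟩
        refine ContinuousAt.continuousWithinAt ?_
        -- The transition is locally constant because `T i` and `T j` transport alike near `x₁`.
        have hev : ∀ᶠ x in 𝓝 x₁, T j x j (T i i x v) = T j x₁ j (T i i x₁ v) := by
          filter_upwards [hcompat i j x₁ hx₁ (T i i x₁ v), (hUo i).mem_nhds hx₁.1,
            (hUo j).mem_nhds hx₁.2] with x h hxi hxj
          rw [hcomp i i (hU i) x₁ hx₁.1 x hxi] at h
          rw [h, hcomp j x₁ hx₁.2 x hxj j (hU j)]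
        have hev' : ∀ᶠ z : B × F in 𝓝 (x₁, v), T j z.1 j (T i i z.1 z.2) =
            T j x₁ j (T i i x₁ v) := by
          rw [nhds_prod_eq, nhds_discrete F]
          filter_upwards [hev.prod_mk (Filter.eventually_pure.2 (rfl : v = v))] with z hz
          rw [← hz.2]; exact hz.1
        exact (continuousAt_const.congr (hev'.mono fun _ h => h.symm))
      coordChange_comp := by
        rintro i j k x ⟨⟨hi, hj⟩, hk⟩ v
        rw [hcomp j x hj j (hU j) x hj, hT j x hj] }
  have hcov : IsCoveringMap (Bundle.TotalSpace.proj : Bundle.TotalSpace F Z.Fiber → B) :=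
    FiberBundle.isCoveringMap
  obtain ⟨G, ⟨hG0, hGf⟩, -⟩ := hcov.existsUnique_continuousMap_lifts f a₀ ⟨f a₀, v₀⟩ rfl
  have hG1 : ∀ a, (G a).1 = f a := fun a => congrFun hGf a
  let snd : Bundle.TotalSpace F Z.Fiber → F := fun z => z.2
  refine ⟨fun a => snd (G a), congrArg snd hG0, fun a => ?_⟩
  have hcont : ContinuousAt (fun a' => (Z.localTrivAt (f a) (G a')).2) a := by
    refine continuousAt_snd.comp (ContinuousAt.comp (g := Z.localTrivAt (f a)) ?_
      G.continuous.continuousAt)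
    refine (Z.localTrivAt (f a)).continuousAt ?_
    rw [Z.mem_localTrivAt_source, hG1]
    exact Z.mem_localTrivAt_baseSet _
  have hev := hcont.eventually (by rw [nhds_discrete]; exact Filter.eventually_pure.2 rfl :
    ∀ᶠ v in 𝓝 (Z.localTrivAt (f a) (G a)).2, v = (Z.localTrivAt (f a) (G a)).2)
  filter_upwards [hev, f.continuous.continuousAt.preimage_mem_nhds ((hUo (f a)).mem_nhds (hU _))]
    with a' h1 h2
  have h3 : ∀ a', (Z.localTrivAt (f a) (G a')).2 =
      T (f a) (f a') (f a) (T (f a') (f a') (f a') (snd (G a'))) := fun a' => by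
    rw [Z.localTrivAt_snd, ← hG1 a']
    rfl
  rw [h3, h3, hT _ _ (hU _), hT _ _ (hU _), hT _ _ (hU _)] at h1
  have h4 := congrArg (T (f a) (f a) (f a')) h1
  rwa [hcomp _ _ h2 _ (hU _) _ h2, hT _ _ h2] at h4

/-- The total space of a covering of a locally path-connected space is locally path-connected. -/
theorem IsLocalHomeomorph.locallyPathConnectedSpace {E X : Type*} [TopologicalSpace E]
    [TopologicalSpace X] [LocallyPathConnectedSpace X] {p : E → X} (hp : IsLocalHomeomorph p) :
    LocallyPathConnectedSpace E := by
  choose φ hφ hpφ using hp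
  let _ : ChartedSpace X E :=
    { atlas := Set.range φ
      chartAt := φ
      mem_chart_source := hφ
      chart_mem_atlas := fun e => ⟨e, rfl⟩ }
  exact ChartedSpace.locallyPathConnectedSpace X E

namespace Foliation

variable {m q : ℕ} {n : ℕ∞} {M N : Type*} [TopologicalSpace M]
  [ChartedSpace (EuclideanSpace ℝ (Fin m)) M] [IsManifold (𝓡 m) ∞ M] [TopologicalSpace N]
  [ChartedSpace (EuclideanSpace ℝ (Fin q)) N] [IsManifold (𝓡 q) ∞ N]
  {W : Foliation ((𝓡 m).prod (𝓡 q)) n m q (M × N)}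

/-- Parallel transport of the whole fiber along the leaves of a horizontal foliation, over a
connected neighborhood. -/
theorem IsHorizontal.exists_transport (hW : W.IsHorizontal) (hn : 1 ≤ n) [T2Space N]
    [CompactSpace N] (x₀ : M) :
    ∃ (U : Set M) (T : M → M → N → N), IsOpen U ∧ x₀ ∈ U ∧ IsPreconnected U ∧
      (∀ x ∈ U, ∀ y, T x x y = y) ∧
      (∀ x₁ ∈ U, ∀ x ∈ U, ∀ y, W.LeafwiseAt (fun x => (x, T x₁ x y)) x) ∧
      ∀ x₁ ∈ U, ∀ x₂ ∈ U, ContMDiff (𝓡 q) (𝓡 q) n (T x₁ x₂) := by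
  choose U V S hUo hU hVo hV hS hleaf hsmooth using hW.exists_local_transport hn x₀
  obtain ⟨F, hF⟩ := CompactSpace.elim_nhds_subcover V fun y => (hVo y).mem_nhds (hV y)
  have hcov : ∀ y, ∃ i ∈ F, y ∈ V i := fun y => by
    have : y ∈ ⋃ x ∈ F, V x := hF ▸ Set.mem_univ y
    simpa using this
  choose i hiF hi using hcov
  have := ChartedSpace.locallyConnectedSpace (EuclideanSpace ℝ (Fin m)) M
  -- Finitely many of the sets `V` cover `N`, so the corresponding neighborhoods in `M` have an open
  -- intersection; its component at `x₀` is connected, as uniqueness requires.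
  let U₀ : Set M := ⋂ y ∈ F, U y
  have hU₀o : IsOpen U₀ := isOpen_biInter_finset fun y _ => hUo y
  have hx₀ : x₀ ∈ U₀ := Set.mem_iInter₂.2 fun y _ => hU y
  have hsub : ∀ x ∈ connectedComponentIn U₀ x₀, ∀ y ∈ F, x ∈ U y := fun x hx y hy =>
    Set.mem_iInter₂.1 (connectedComponentIn_subset _ _ hx) y hy
  refine ⟨connectedComponentIn U₀ x₀, fun x₁ x₂ y => S (i y) x₁ x₂ y, hU₀o.connectedComponentIn,
    mem_connectedComponentIn hx₀, isPreconnected_connectedComponentIn, ?_, ?_, ?_⟩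
  · intro x hx y
    exact hS _ x (hsub x hx _ (hiF y)) y (hi y)
  · intro x₁ hx₁ x hx y
    exact hleaf _ x₁ (hsub x₁ hx₁ _ (hiF y)) x (hsub x hx _ (hiF y)) y (hi y)
  · intro x₁ hx₁ x₂ hx₂ y
    refine ((hsmooth (i y) x₁ (hsub x₁ hx₁ _ (hiF y)) x₂ (hsub x₂ hx₂ _ (hiF y))).contMDiffAt
      ((hVo _).mem_nhds (hi y))).congr_of_eventuallyEq ?_
    filter_upwards [(hVo (i y)).mem_nhds (hi y)] with y' hy'
    -- The choice `i y'` may jump with `y'`; by uniqueness the transport does not depend on it, so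
    -- the smooth branch `i y` may be used near `y`.
    have h := hW.eqOn hn (isPreconnected_connectedComponentIn (F := U₀) (x := x₀))
      (γ := fun x => (x, S (i y') x₁ x y')) (γ' := fun x => (x, S (i y) x₁ x y'))
      (fun x hx => hleaf _ x₁ (hsub x₁ hx₁ _ (hiF y')) x (hsub x hx _ (hiF y')) y' (hi y'))
      (fun x hx => hleaf _ x₁ (hsub x₁ hx₁ _ (hiF y)) x (hsub x hx _ (hiF y)) y' hy')
      (fun _ => rfl) hx₁ (by
        rw [hS _ x₁ (hsub x₁ hx₁ _ (hiF y')) y' (hi y'), hS _ x₁ (hsub x₁ hx₁ _ (hiF y)) y' hy'])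
    exact congrArg Prod.snd (h hx₂)

variable {M' : Type*} [TopologicalSpace M'] [SimplyConnectedSpace M']
  [LocallyPathConnectedSpace M']

/-- A leaf of the lift of a horizontal foliation to a simply connected space over `M` is a global
section; the transport of fibers is `C^n`. -/
theorem IsHorizontal.exists_global_transport (hW : W.IsHorizontal) (hn : 1 ≤ n) [T2Space N]
    [CompactSpace N] (p : C(M', M)) :
    ∃ Θ : M' → M' → N → N, (∀ x y, Θ x x y = y) ∧
      (∀ x₁ y x, W.LeafwiseAt (fun x => (p x, Θ x₁ x y)) x) ∧
      ∀ x₁ x₂, ContMDiff (𝓡 q) (𝓡 q) n (Θ x₁ x₂) := by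
  choose U T hUo hU hUc hT hleaf hsmooth using hW.exists_transport hn
  have hcomp : ∀ i, ∀ x₁ ∈ U i, ∀ x₂ ∈ U i, ∀ x₃ ∈ U i, ∀ y,
      T i x₂ x₃ (T i x₁ x₂ y) = T i x₁ x₃ y := by
    intro i x₁ h₁ x₂ h₂ x₃ h₃ y
    have h := hW.eqOn hn (hUc i) (γ := fun x => (x, T i x₂ x (T i x₁ x₂ y)))
      (γ' := fun x => (x, T i x₁ x y)) (fun x hx => hleaf i x₂ h₂ x hx _)
      (fun x hx => hleaf i x₁ h₁ x hx _) (fun _ => rfl) h₂ (by rw [hT i x₂ h₂])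
    exact congrArg Prod.snd (h h₃)
  have hcompat : ∀ i j, ∀ x₁ ∈ U i ∩ U j, ∀ y, ∀ᶠ x in 𝓝 x₁, T i x₁ x y = T j x₁ x y := by
    rintro i j x₁ ⟨hi, hj⟩ y
    filter_upwards [hW.eventually_eq hn (hleaf i x₁ hi x₁ hi y) (hleaf j x₁ hj x₁ hj y)
      (fun _ => rfl) (by rw [hT i x₁ hi, hT j x₁ hj])] with x hx
    exact congrArg Prod.snd hx
  choose Θ hΘ hΘT using exists_flat_section U T hUo hU hT hcomp hcompat p
  have hΘleaf : ∀ x₁ y x, W.LeafwiseAt (fun x => (p x, Θ x₁ y x)) x := by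
    intro x₁ y x
    have h := (hleaf (p x) (p x) (hU _) (p x) (hU _) (Θ x₁ y x)).comp p.continuous.continuousAt
    refine h.congr ?_
    filter_upwards [hΘT x₁ y x] with x' hx'
    simp only [Function.comp, hx']
  refine ⟨fun x₁ x₂ y => Θ x₁ y x₂, hΘ, hΘleaf, fun x₁ x₂ => ?_⟩
  -- Nearby transports differ by composition with a `C^n` local one, so the points with `C^n`
  -- transport form a clopen set; it contains `x₁`, where the transport is the identity.
  have hnear : ∀ x, ∀ᶠ x' in 𝓝 x, ContMDiff (𝓡 q) (𝓡 q) n (fun y => Θ x₁ y x') ↔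
      ContMDiff (𝓡 q) (𝓡 q) n (fun y => Θ x₁ y x) := by
    intro x
    have hnb := p.continuous.continuousAt.preimage_mem_nhds ((hUo (p x)).mem_nhds (hU (p x)))
    obtain ⟨C, ⟨hC, hCconn⟩, hCsub⟩ :=
      (LocallyPathConnectedSpace.path_connected_basis x).mem_iff.1 hnb
    filter_upwards [hC] with x' hx'
    have hxC := mem_of_mem_nhds hC
    have key : ∀ u ∈ C, ∀ w ∈ C, (fun y => Θ x₁ y w) = T (p x) (p u) (p w) ∘ fun y => Θ x₁ y u := by
      intro u hu w hw
      funext y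
      have h := hW.eqOn hn hCconn.isConnected.isPreconnected (γ := fun x => (p x, Θ x₁ y x))
        (γ' := fun w => (p w, T (p x) (p u) (p w) (Θ x₁ y u))) (fun x _ => hΘleaf x₁ y x)
        (fun w hw => (hleaf (p x) (p u) (hCsub hu) (p w) (hCsub hw) (Θ x₁ y u)).comp
          p.continuous.continuousAt) (fun _ => rfl) hu (by rw [hT _ _ (hCsub hu)])
      exact congrArg Prod.snd (h hw)
    constructor
    · intro h
      rw [key x' hx' x hxC]
      exact (hsmooth _ _ (hCsub hx') _ (hCsub hxC)).comp h
    · intro h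
      rw [key x hxC x' hx']
      exact (hsmooth _ _ (hCsub hxC) _ (hCsub hx')).comp h
  have hclopen : IsClopen {x | ContMDiff (𝓡 q) (𝓡 q) n (fun y => Θ x₁ y x)} := by
    constructor
    · rw [← isOpen_compl_iff, isOpen_iff_mem_nhds]
      intro x hx
      filter_upwards [hnear x] with x' hx'
      exact fun h => hx (hx'.1 h)
    · rw [isOpen_iff_mem_nhds]
      intro x hx
      filter_upwards [hnear x] with x' hx'
      exact hx'.2 hx
  have huniv := hclopen.eq_univ ⟨x₁, by
    have : (fun y => Θ x₁ y x₁) = id := funext fun y => hΘ x₁ y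
    change ContMDiff (𝓡 q) (𝓡 q) n (fun y => Θ x₁ y x₁)
    rw [this]; exact contMDiff_id⟩
  exact huniv.ge (Set.mem_univ x₂)

end Foliation

/-! ### Deck transformations of a universal covering -/

namespace IsCoveringMap

variable {E X : Type*} [TopologicalSpace E] [TopologicalSpace X] {p : E → X}

/-- The deck transformations of a universal covering act transitively on the fibers. -/
theorem exists_deckTransformation [SimplyConnectedSpace E] [LocallyPathConnectedSpace E]
    (hp : IsCoveringMap p) {x e : E} (he : p e = p x) :
    ∃ D : E ≃ₜ E, p ∘ D = p ∧ D x = e := by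
  obtain ⟨F, ⟨hF, hpF⟩, -⟩ := hp.existsUnique_continuousMap_lifts ⟨p, hp.continuous⟩ x e he
  obtain ⟨G, ⟨hG, hpG⟩, -⟩ := hp.existsUnique_continuousMap_lifts ⟨p, hp.continuous⟩ e x he.symm
  have hpF' : ∀ u, p (F u) = p u := fun u => congrFun hpF u
  have hpG' : ∀ u, p (G u) = p u := fun u => congrFun hpG u
  have h1 : G ∘ F = id := hp.eq_of_comp_eq (G.continuous.comp F.continuous) continuous_id
    (funext fun u => (hpG' _).trans (hpF' u)) x (by simp [hF, hG])
  have h2 : F ∘ G = id := hp.eq_of_comp_eq (F.continuous.comp G.continuous) continuous_id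
    (funext fun u => (hpF' _).trans (hpG' u)) e (by simp [hF, hG])
  exact ⟨⟨⟨F, G, congrFun h1, congrFun h2⟩, F.continuous, G.continuous⟩, hpF, hF⟩

/-- Composition of deck transformations corresponds to multiplication in the fundamental group. -/
theorem monodromy_mul_eq_deckTransformation (hp : IsCoveringMap p) {x : E}
    {σ τ : FundamentalGroup X (p x)} {D D' : E ≃ₜ E} (hD : IsDeckTransformation hp x σ D)
    (hD' : IsDeckTransformation hp x τ D') :
    (hp.monodromy (σ * τ) ⟨x, rfl⟩ : E) = D' (D x) := by
  have h1 : hp.monodromy (σ * τ) ⟨x, rfl⟩ = hp.monodromy σ (hp.monodromy τ ⟨x, rfl⟩) := by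
    have := DFunLike.congr_fun (map_mul (hp.monodromyPerm (p x)) σ τ) ⟨x, rfl⟩
    exact this
  have h2 : hp.monodromy τ ⟨x, rfl⟩ = ⟨D' x, congrFun hD'.1 x⟩ := Subtype.ext hD'.2.symm
  rw [h1, h2]
  -- `D'` commutes with monodromy, so the factors appear in reverse order.
  have h3 := hp.monodromy_natural hp ⟨D', D'.continuous⟩ (ContinuousMap.id X)
    (fun e => congrFun hD'.1 e) σ ⟨x, rfl⟩
  have h4 : ∀ {y z : X} (τ : Path.Homotopic.Quotient y z), τ.map (ContinuousMap.id X) = τ := by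
    rintro y z ⟨τ⟩
    rfl
  rw [hD.2]
  refine Eq.trans ?_ h3
  exact congrArg (fun τ => (hp.monodromy τ ⟨D' x, congrFun hD'.1 x⟩ : E)) (h4 σ).symm

end IsCoveringMap

/-! ### Holonomy diffeomorphisms and lifted leaves -/

namespace Foliation

variable {m q : ℕ} {n : ℕ∞} {M N : Type*} [TopologicalSpace M]
  [ChartedSpace (EuclideanSpace ℝ (Fin m)) M] [IsManifold (𝓡 m) ∞ M] [TopologicalSpace N]
  [ChartedSpace (EuclideanSpace ℝ (Fin q)) N] [IsManifold (𝓡 q) ∞ N]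
  {W : Foliation ((𝓡 m).prod (𝓡 q)) n m q (M × N)}
  {M' : Type*} [TopologicalSpace M']

/-- The holonomy of a horizontal foliation lifted to a simply connected space over `M`. -/
theorem IsHorizontal.exists_diff_transport (hW : W.IsHorizontal) (hn : 1 ≤ n) [T2Space N]
    [CompactSpace N] [SimplyConnectedSpace M'] [LocallyPathConnectedSpace M'] (p : C(M', M)) :
    ∃ Θ : M' → M' → Diff (𝓡 q) n N, (∀ x, Θ x x = 1) ∧
      (∀ x₁ x₂ x₃, Θ x₂ x₃ * Θ x₁ x₂ = Θ x₁ x₃) ∧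
      ∀ x₁ y x, W.LeafwiseAt (fun x => (p x, (Θ x₁ x).1 y)) x := by
  obtain ⟨Θ, hΘ, hleaf, hsmooth⟩ := hW.exists_global_transport hn p
  have hcomp : ∀ x₁ x₂ x₃ y, Θ x₂ x₃ (Θ x₁ x₂ y) = Θ x₁ x₃ y := by
    intro x₁ x₂ x₃ y
    have h := hW.eqOn hn isPreconnected_univ (γ := fun x => (p x, Θ x₂ x (Θ x₁ x₂ y)))
      (γ' := fun x => (p x, Θ x₁ x y)) (fun x _ => hleaf x₂ _ x) (fun x _ => hleaf x₁ y x)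
      (fun _ => rfl) (Set.mem_univ x₂) (by rw [hΘ])
    exact congrArg Prod.snd (h (Set.mem_univ x₃))
  refine ⟨fun x₁ x₂ => ⟨⟨Θ x₁ x₂, Θ x₂ x₁, fun y => by rw [hcomp, hΘ], fun y => by rw [hcomp, hΘ]⟩,
    hsmooth x₁ x₂, hsmooth x₂ x₁⟩, ?_, ?_, hleaf⟩
  · intro x
    exact Subtype.ext (Equiv.ext (hΘ x))
  · intro x₁ x₂ x₃
    exact Subtype.ext (Equiv.ext (hcomp x₁ x₂ x₃))

/-- A leafwise section over a path-connected space describes the lifted leaf of any of its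
points. -/
theorem IsHorizontal.liftedLeaf_inter (hW : W.IsHorizontal) (hn : 1 ≤ n) [T2Space N]
    [PathConnectedSpace M'] {p : M' → M} (hp : Continuous p) {ℓ : M' → N}
    (hℓ : ∀ x, W.LeafwiseAt (fun x => (p x, ℓ x)) x)
    (x' x : M') : W.liftedLeaf p (x', ℓ x') ∩ {z | z.1 = x} = {(x, ℓ x)} := by
  have hℓc : Continuous ℓ := continuous_iff_continuousAt.2 fun x => continuousAt_snd.comp (hℓ x).1
  ext z
  constructor
  · rintro ⟨⟨γ, hγ⟩, hz⟩
    have hγc : Continuous fun t => (p (γ t).1, (γ t).2) := by fun_prop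
    -- A leafwise path and the section over its projection start at the same point, hence end at the
    -- same point.
    have h := hW.eqOn hn isPreconnected_univ (γ := fun t => (p (γ t).1, (γ t).2))
      (γ' := fun t => (p (γ t).1, ℓ (γ t).1))
      (fun t _ => ⟨hγc.continuousAt, fun φ hφ ht => hγ φ hφ t ht⟩)
      (fun t _ => (hℓ (γ t).1).comp (f := fun t => (γ t).1) (by fun_prop)) (fun _ => rfl)
      (Set.mem_univ 0) (by simp)
    have h1 := congrArg Prod.snd (h (Set.mem_univ 1))
    simp only [Path.target] at h1
    obtain ⟨z₁, z₂⟩ := z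
    obtain rfl : z₁ = x := hz
    exact Prod.ext rfl h1
  · rintro rfl
    refine ⟨?_, rfl⟩
    let δ := PathConnectedSpace.somePath x' x
    refine ⟨δ.prod (δ.map hℓc), fun φ hφ t ht => ?_⟩
    exact ((hℓ (δ t)).comp (f := δ) δ.continuous.continuousAt).2 φ hφ ht

end Foliation

/-! ### Assembly of the main theorem -/

theorem contMDiff_extension {k m q : ℕ} {M N : Type*}
    [TopologicalSpace M] [ChartedSpace (EuclideanSpace ℝ (Fin m)) M]
    [TopologicalSpace N] [ChartedSpace (EuclideanSpace ℝ (Fin q)) N]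
    {α : IntLattice k →* Diff (𝓡 m) ∞ M} {β : IntLattice k → M → Diff (𝓡 q) 1 N}
    (hβ : IsCocycle α β) (a : IntLattice k) :
    ContMDiff ((𝓡 m).prod (𝓡 q)) ((𝓡 m).prod (𝓡 q)) 1 (extension α β a) :=
  (((α a).2.1.of_le (by simp)).comp contMDiff_fst).prodMk (hβ.contMDiff a)

theorem mainTheorem7 {k m q : ℕ}
    -- compact connected smooth manifolds `M`, `N`, and `M` is an infranilmanifold
    {M : Type*} [TopologicalSpace M] [ChartedSpace (EuclideanSpace ℝ (Fin m)) M]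
    [IsManifold (𝓡 m) ∞ M] [T2Space M] [CompactSpace M] [ConnectedSpace M]
    {N : Type*} [TopologicalSpace N] [ChartedSpace (EuclideanSpace ℝ (Fin q)) N]
    [IsManifold (𝓡 q) ∞ N] [T2Space N] [CompactSpace N] [ConnectedSpace N]
    (hM : IsInfranilmanifold m M)
    -- an Anosov action of `ℤ^k` on `M` by affine automorphisms
    (α : IntLattice k →* Diff (𝓡 m) ∞ M)
    (hα_affine : ∀ a, IsAffineAutomorphism m (α a).1)
    (hα_anosov : ∃ a, IsAnosov (m := m) (α a).1)
    -- the universal covering of `M`, with a base point over a fixed point of the action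
    {M' : Type*} [TopologicalSpace M'] [SimplyConnectedSpace M']
    (p : M' → M) (hp : IsCoveringMap p) (x' : M') (hx : ∀ a, (α a).1 (p x') = p x')
    -- a cocycle over the action that is trivial at the fixed point
    (β : IntLattice k → M → Diff (𝓡 q) 1 N) (hβ : IsCocycle α β) (hβx : ∀ a, β a (p x') = 1)
    -- the horizontal foliation, invariant under the extended action
    (n : ℕ∞) (hn : 1 ≤ n) (W : Foliation ((𝓡 m).prod (𝓡 q)) n m q (M × N))
    (hW : W.IsHorizontal) (hW_inv : ∀ a, W.IsInvariant (extension α β a)) :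
    ∃ (h : M' → Diff (𝓡 q) n N)
      (D : FundamentalGroup M (p x') → (M' ≃ₜ M'))
      (H : FundamentalGroup M (p x') →* Diff (𝓡 q) n N),
      -- `h x y` is the point of the fiber over `x` in the lifted leaf through `(x', y)`
      (∀ x y, W.liftedLeaf p (x', y) ∩ {z | z.1 = x} = {(x, (h x).1 y)}) ∧
      -- `D σ` is the deck transformation of `σ`, and `H` is the holonomy homomorphism
      (∀ σ, IsDeckTransformation hp x' σ (D σ)) ∧
      (∀ σ x, H σ = (h x)⁻¹ * h (D σ x)) ∧
      -- `H` is invariant and passes to the quotient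
      (∀ a σ, H (inducedMap α hx a σ) = H σ) ∧
      (∃ Hbar : FundamentalGroup M (p x') ⧸ displacementSubgroup (inducedMap α hx) →*
          Diff (𝓡 q) n N,
        ∀ σ : FundamentalGroup M (p x'), Hbar (QuotientGroup.mk σ) = H σ) ∧
      -- finite index
      (displacementSubgroup (inducedMap α hx)).FiniteIndex := by
  have : LocallyPathConnectedSpace M :=
    ChartedSpace.locallyPathConnectedSpace (EuclideanSpace ℝ (Fin m)) M
  have : LocallyPathConnectedSpace M' := hp.isLocalHomeomorph.locallyPathConnectedSpace
  obtain ⟨Θ, hΘ, hcomp, hleaf⟩ := hW.exists_diff_transport hn ⟨p, hp.continuous⟩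
  choose D hDp hDx using fun σ : FundamentalGroup M (p x') =>
    hp.exists_deckTransformation (x := x') (hp.monodromy σ ⟨x', rfl⟩).2
  have hD : ∀ σ, IsDeckTransformation hp x' σ (D σ) := fun σ => ⟨hDp σ, hDx σ⟩
  -- the transport is invariant under deck transformations
  have hΘD : ∀ σ x₁ x₂, Θ (D σ x₁) (D σ x₂) = Θ x₁ x₂ := by
    intro σ x₁ x₂
    refine Subtype.ext (Equiv.ext fun y => ?_)
    have h := hW.eqOn hn isPreconnected_univ (γ := fun x => (p x, (Θ (D σ x₁) (D σ x)).1 y))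
      (γ' := fun x => (p x, (Θ x₁ x).1 y))
      (fun x _ => ((hleaf (D σ x₁) y (D σ x)).comp (D σ).continuous.continuousAt).congr
        (Filter.Eventually.of_forall fun u => Prod.ext (congrFun (hDp σ) u).symm rfl))
      (fun x _ => hleaf x₁ y x) (fun _ => rfl) (Set.mem_univ x₁) (by rw [hΘ, hΘ])
    exact congrArg Prod.snd (h (Set.mem_univ x₂))
  have hmul : ∀ σ x, Θ x' (D σ x) = Θ x' x * Θ x' (D σ x') := fun σ x => by
    rw [← hΘD σ x' x, hcomp]
  -- Deck transformations multiply in reverse order, and so do the transports in `hmul`; the two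
  -- reversals cancel.
  have hHmul : ∀ σ τ, Θ x' (D (σ * τ) x') = Θ x' (D σ x') * Θ x' (D τ x') := fun σ τ => by
    rw [hDx (σ * τ), hp.monodromy_mul_eq_deckTransformation (hD σ) (hD τ), hmul]
  let H : FundamentalGroup M (p x') →* Diff (𝓡 q) n N :=
    MonoidHom.mk' (fun σ => Θ x' (D σ x')) hHmul
  have hinv : ∀ a σ, H (inducedMap α hx a σ) = H σ := by
    intro a σ
    -- The lift of `α a` to the universal covering that fixes the base point.
    obtain ⟨F, ⟨hF, hpF⟩, -⟩ := hp.existsUnique_continuousMap_lifts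
      ((Diff.toContinuousMap (α a)).comp ⟨p, hp.continuous⟩) x' x' (hx a).symm
    have hpF' : ∀ u, p (F u) = (α a).1 (p u) := fun u => congrFun hpF u
    -- Both sides are leafwise over `p ∘ F`, the right one because the extension preserves leaves,
    -- and they agree at `x'`, where `β` is trivial.
    have hequi : ∀ x y, (Θ x' (F x)).1 y = (β a (p x)).1 ((Θ x' x).1 y) := by
      intro x y
      have h := hW.eqOn hn isPreconnected_univ (γ := fun x => (p (F x), (Θ x' (F x)).1 y))
        (γ' := fun x => extension α β a (p x, (Θ x' x).1 y))
        (fun x _ => (hleaf x' y (F x)).comp F.continuous.continuousAt)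
        (fun x _ => hW.leafwiseAt_comp hn (contMDiff_extension hβ a) (hW_inv a) (hleaf x' y x))
        hpF' (Set.mem_univ x') (by simp only [extension, hF, hΘ, hβx, hx]; rfl)
      exact congrArg Prod.snd (h (Set.mem_univ x))
    have hbase : D (inducedMap α hx a σ) x' = F (D σ x') := by
      rw [hDx, hDx]
      exact hp.monodromy_mapOfEq hp F (Diff.toContinuousMap (α a)) hpF' (hx a) σ ⟨x', rfl⟩
        ⟨x', rfl⟩ hF
    refine Subtype.ext (Equiv.ext fun y => ?_)
    change (Θ x' (D (inducedMap α hx a σ) x')).1 y = (Θ x' (D σ x')).1 y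
    -- The deck translate `D σ x'` lies over the fixed point, so the cocycle factor is again the
    -- identity.
    rw [hbase, hequi, show p (D σ x') = p x' from congrFun (hDp σ) x', hβx]
    rfl
  have hker : displacementSubgroup (inducedMap α hx) ≤ H.ker := by
    refine (Subgroup.closure_le _).2 ?_
    rintro _ ⟨a, σ, rfl⟩
    rw [SetLike.mem_coe, MonoidHom.mem_ker, map_mul, hinv, map_inv, mul_inv_cancel]
  obtain ⟨a, ha⟩ := hα_anosov
  refine ⟨Θ x', D, H, fun x y => ?_, hD, fun σ x => ?_, hinv,
    ⟨QuotientGroup.lift _ H hker, fun σ => rfl⟩,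
    finiteIndex_displacementSubgroup_of_isAnosov α (hα_affine a) ha hx⟩
  · have h := hW.liftedLeaf_inter hn hp.continuous (hleaf x' y) x' x
    rwa [show (Θ x' x').1 y = y by rw [hΘ]; rfl] at h
  · change Θ x' (D σ x') = _
    rw [hmul σ x, inv_mul_cancel_left]
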